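/- **Definitions.** Let $\mathbb F\in\{\mathbb C,\mathbb R\}$. Consider either $N\times N$ matrices under similarity $C\mapsto SCS^{-1}$, or pairs of $m\times n$ matrices under simultaneous equivalence $(A,B)\mapsto(SAR^{-1},SBR^{-1})$. A *deformation* of an object $X$ is a parametric object $\mathcal X(\lambda_1,\dots,\lambda_k)$ whose entries are power series over $\mathbb F$ convergent near $\vec 0$, with $\mathcal X(\vec 0)=X$. Two deformations of $X$ with the same parameters are *equivalent* if near $\vec 0$ one is transformed into the other by nonsingular matrices $S(\vec\lambda)$ (respectively $S(\vec\lambda),R(\vec\lambda)$) whose entries are power series convergent near $\vec 0$ and which are identity matrices at $\vec 0$. A deformation $\mathcal X(\lambda_1,\dots,\lambda_k)$ is *versal* if every deformation $\mathcal Y(\mu_1,\dots,\mu_l)$ of $X$ is equivalent to $\mathcal X(\varphi_1(\vec\mu),\dots,\varphi_k(\vec\mu))$ for some power series $\varphi_i$ convergent near $\vec 0$ with $\varphi_i(\vec 0)=0$; *miniversal* if moreover no versal deformation of $X$ has fewer than $k$ parameters; *simplest miniversal* if moreover it is obtained from $X$ by adding $\lambda_1,\dots,\lambda_k$ to $k$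 distinct entries of $X$, one parameter to each. Let $J_r(\lambda)$ be the $r\times r$ upper triangular Jordan block. Put $J_r^{\mathbb C}(\lambda)=J_r(\lambda)$ for $\lambda\in\mathbb C$ and $J_r^{\mathbb R}(\lambda)=J_r(\lambda)$ for $\lambda\in\mathbb R$. For $\lambda=a+bi$ with $b>0$ and $r$ even, let $J^{\mathbb R}_r(\lambda)$ be the $r\times r$ matrix with $2\times2$ blocks $\begin{bmatrix}a&b\\-b&a\end{bmatrix}$ on the block diagonal, $I_2$ on the first block superdiagonal, and zeros elsewhere. Put $\Phi^{\mathbb F}(\lambda)=\mathrm{diag}(J^{\mathbb F}_{s_1}(\lambda),J^{\mathbb F}_{s_2}(\lambda),\dots)$ with $s_1\ge s_2\ge\cdots$. Let $F_r$ and $K_r$ $(r\ge1)$ be the $r\times(r-1)$ matrices obtained from $I_{r-1}$ by adding a zero row at the bottom, respectively at the top. A star denotes an independent parameter, and all entries that are not stars are zero. The matrices $0^{\uparrow},0^{\downarrow},0^{\leftarrow},0^{\rightarrow}$ have stars exactly in the first row, the last row, the first column, the last column, respectively. The $p\times q$ matrix $Z$ has stars exactly at the first $\max\{q-p,0\}$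 entries of its first row. The $p\times q$ matrix $H$ has stars exactly in the first column if $p\le q$ and exactly in the last row if $p>q$. **Theorem.** Let $$(A,B)=\bigoplus_{i=1}^l(F_{p_i},K_{p_i})\oplus(I,C)\oplus(D,I)\oplus\bigoplus_{j=1}^r(F_{q_j}^T,K_{q_j}^T)$$ be a canonical pair of matrices under simultaneous equivalence over $\mathbb F$, where $p_1\le\dots\le p_l$, $q_1\ge\dots\ge q_r$, $C=\bigoplus_i\Phi^{\mathbb F}(\lambda_i)$ with distinct $\lambda_i$ (with $\operatorname{Im}\lambda_i\ge0$ if $\mathbb F=\mathbb R$), and $D=\Phi^{\mathbb F}(0)$; any of the summands may be absent. Let $\tilde C$ and $\tilde D$ be any simplest miniversal $\mathbb F$-deformations of $C$ and $D$ under similarity, with disjoint sets of parameters. Divide the matrices of a pair into blocks, with strips $P_1,\dots,P_l$, $\mathsf C$, $\mathsf D$, $Q_1,\dots,Q_r$ of rows and of columns corresponding to the summands of $(A,B)$. Then one of the simplest miniversal $\mathbb F$-deformations $(\mathcal A,\mathcal B)$ of $(A,B)$ is obtained from $(A,B)$ as follows, all parameters being independent. * In $A$, the block $D$ is replaced by $\tilde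 D$; each block $(P_i,\mathsf D)$ is replaced by $0^{\downarrow}$; and each of the blocks $(P_i,Q_j)$ and $(\mathsf D,Q_j)$ is replaced by $0^{\rightarrow}$. * In $B$, the block $C$ is replaced by $\tilde C$; each block $(P_i,P_{i'})$ with $i<i'$ is replaced by $Z$; each of the blocks $(P_i,\mathsf C)$ and $(P_i,Q_j)$ is replaced by $0^{\uparrow}$; each block $(\mathsf C,Q_j)$ is replaced by $0^{\leftarrow}$; and each block $(Q_j,Q_{j'})$ with $j<j'$ is replaced by $Z^T$, the transpose of a matrix of the form $Z$. All other blocks are unchanged. For instance, one may take $\tilde C=\bigoplus_i(\Phi^{\mathbb F}(\lambda_i)+\mathcal H_i)$ and $\tilde D=\Phi^{\mathbb F}(0)+\mathcal H$, where each of $\mathcal H_i$ and $\mathcal H$ is partitioned conformally with the Jordan blocks $J^{\mathbb F}_s$ of the corresponding $\Phi^{\mathbb F}$ and has all its blocks of the form $H$: these are simplest miniversal $\mathbb F$-deformations of $C$ and $D$ under similarity. -/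

import Mathlib

set_option synthInstance.maxSize 10000

noncomputable section

namespace PencilDeformation

open Matrix Filter Topology

/-! ### Matrix representations of quivers and their deformations -/

section Quivers

variable {V : Type} [Quiver.{0, 0} V]

/-- Matrix representations over `𝕜` of a quiver: the rows and columns at the vertex `v` are
indexed by the type `n v`, and an arrow `i ⟶ j` is assigned an `n j × n i` matrix. -/
abbrev MatRep (n : V → Type) (𝕜 : Type) : Type :=
  ∀ i j : V, (i ⟶ j) → Matrix (n j) (n i) 𝕜

/-- The position of an entry of a matrix representation. -/
structure Entry (n : V → Type) where
  src : V
  tgt : V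
  arrow : src ⟶ tgt
  row : n tgt
  col : n src

/-- The entry of `A` at the position `e`. -/
def MatRep.entry {n : V → Type} {𝕜 : Type} (A : MatRep n 𝕜) (e : Entry n) : 𝕜 :=
  A e.src e.tgt e.arrow e.row e.col

variable {n : V → Type} {𝕜 : Type} [RCLike 𝕜] {ι : Type} [Fintype ι]

/-- `𝒜` is a deformation of `A` with parameters indexed by the finite type `ι`: its entries are
given near `0` by convergent power series over `𝕜` in the parameters, and `𝒜 0 = A`. -/
def IsDeformation (A : MatRep n 𝕜) (𝒜 : (ι → 𝕜) → MatRep n 𝕜) : Prop :=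
  (∀ e : Entry n, AnalyticAt 𝕜 (fun t => (𝒜 t).entry e) 0) ∧ 𝒜 0 = A

/-- Equivalence of two deformations `𝒜`, `ℬ`: there is a deformation `S` of the identity
isomorphism with `ℬ_α = S_j 𝒜_α S_i⁻¹` near `0` for each arrow `α : i ⟶ j`. (As `S 0 v = 1` and
`S` is continuous at `0`, the matrices inverted here are nonsingular near `0`.) -/
def Equivalent [∀ v, Fintype (n v)] [∀ v, DecidableEq (n v)]
    (𝒜 ℬ : (ι → 𝕜) → MatRep n 𝕜) : Prop :=
  ∃ S : (ι → 𝕜) → ∀ v : V, Matrix (n v) (n v) 𝕜,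
    (∀ v x y, AnalyticAt 𝕜 (fun t => S t v x y) 0) ∧
    (∀ v, S 0 v = 1) ∧
    ∀ᶠ t in 𝓝 (0 : ι → 𝕜), ∀ (i j : V) (α : i ⟶ j),
      ℬ t i j α = S t j * 𝒜 t i j α * (S t i)⁻¹

/-- A deformation of `A` is versal if every deformation `ℬ` of `A` is equivalent to one that is
obtained from it by an analytic change of parameters `φ` with `φ 0 = 0`. -/
def IsVersal [∀ v, Fintype (n v)] [∀ v, DecidableEq (n v)]
    (A : MatRep n 𝕜) (𝒜 : (ι → 𝕜) → MatRep n 𝕜) : Prop :=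
  IsDeformation A 𝒜 ∧
  ∀ (m : ℕ) (ℬ : (Fin m → 𝕜) → MatRep n 𝕜), IsDeformation A ℬ →
    ∃ φ : (Fin m → 𝕜) → (ι → 𝕜), AnalyticAt 𝕜 φ 0 ∧ φ 0 = 0 ∧
      Equivalent (fun t => 𝒜 (φ t)) ℬ

/-- A versal deformation is miniversal if no versal deformation has fewer parameters. -/
def IsMiniversal [∀ v, Fintype (n v)] [∀ v, DecidableEq (n v)]
    (A : MatRep n 𝕜) (𝒜 : (ι → 𝕜) → MatRep n 𝕜) : Prop :=
  IsVersal A 𝒜 ∧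
  ∀ (m : ℕ) (ℬ : (Fin m → 𝕜) → MatRep n 𝕜), IsVersal A ℬ → Fintype.card ι ≤ m

/-- A miniversal deformation of `A` is simplest if it is obtained from `A` by adding the
parameters to certain pairwise distinct entries of `A`, one parameter to each of them. -/
def IsSimplestMiniversal [∀ v, Fintype (n v)] [∀ v, DecidableEq (n v)]
    (A : MatRep n 𝕜) (𝒜 : (ι → 𝕜) → MatRep n 𝕜) : Prop :=
  IsMiniversal A 𝒜 ∧
  ∃ pos : ι → Entry n, Function.Injective pos ∧
    ∀ t : ι → 𝕜,
      (∀ k, (𝒜 t).entry (pos k) = A.entry (pos k) + t k) ∧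
      (∀ e, e ∉ Set.range pos → (𝒜 t).entry e = A.entry e)

end Quivers

/-! ### Square matrices under similarity: the quiver with one vertex and one loop -/

/-- A square matrix as a representation of the one-loop quiver; isomorphism is similarity. -/
def loopRep {I 𝕜 : Type} (C : Matrix I I 𝕜) :
    MatRep (fun _ : Quiver.SingleObj Unit => I) 𝕜 :=
  fun _ _ _ => C

/-! ### Pairs of matrices under simultaneous equivalence: two parallel arrows -/

/-- The vertices of the quiver with two parallel arrows. -/
inductive KronVertex
  | source
  | target

/-- The two arrows of the quiver with two parallel arrows. -/
inductive KronArrow : KronVertex → KronVertex → Type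
  | fst : KronArrow .source .target
  | snd : KronArrow .source .target

instance : Quiver KronVertex := ⟨KronArrow⟩

/-- The index types at the two vertices, for pairs of `R × K` matrices. -/
def pairDim (R K : Type) : KronVertex → Type
  | .source => K
  | .target => R

instance (R K : Type) [Fintype R] [Fintype K] : ∀ v, Fintype (pairDim R K v)
  | .source => inferInstanceAs (Fintype K)
  | .target => inferInstanceAs (Fintype R)

instance (R K : Type) [DecidableEq R] [DecidableEq K] : ∀ v, DecidableEq (pairDim R K v)
  | .source => inferInstanceAs (DecidableEq K)
  | .target => inferInstanceAs (DecidableEq R)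

/-- A pair of `R × K` matrices as a representation of the quiver with two parallel arrows. -/
def pairRep {R K 𝕜 : Type} (A B : Matrix R K 𝕜) : MatRep (pairDim R K) 𝕜 :=
  fun _ _ α => match α with
    | .fst => A
    | .snd => B

/-! ### Matrices with stars -/

/-- The set of the places of the stars in an `R × K` matrix; it indexes independent parameters. -/
def Stars {R K : Type} (S : R → K → Prop) : Type := {e : R × K // S e.1 e.2}

instance {R K : Type} [Fintype R] [Fintype K] (S : R → K → Prop) : Fintype (Stars S) := by
  classical
  exact inferInstanceAs (Fintype {e : R × K // S e.1 e.2})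

open Classical in
/-- The matrix whose stars are the independent parameters `x` and whose other entries are `0`. -/
def starMatrix {R K 𝕜 : Type} [Zero 𝕜] (S : R → K → Prop) (x : Stars S → 𝕜) : Matrix R K 𝕜 :=
  fun i j => if h : S i j then x ⟨(i, j), h⟩ else 0

/-! ### Jordan canonical matrices over `ℝ` and `ℂ` -/

/-- The label `λ = a + bi` of a Jordan block over `𝕜`: an element of `𝕜`, or, only if `𝕜` is the
field of real numbers (that is, if the imaginary unit of `𝕜` is `0`), a nonreal complex number
with imaginary part `b > 0`. -/
inductive JordanLabel (𝕜 : Type) [RCLike 𝕜]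
  | scalar (a : 𝕜)
  | nonreal (a b : ℝ) (hb : 0 < b) (h𝕜 : (RCLike.I : 𝕜) = 0)

variable {𝕜 : Type} [RCLike 𝕜]

/-- The size of the diagonal cells of a Jordan block with a given label. -/
def JordanLabel.width : JordanLabel 𝕜 → ℕ
  | .scalar _ => 1
  | .nonreal _ _ _ _ => 2

/-- The diagonal cell of a Jordan block: `[a]`, or `[a, b; -b, a]`. -/
def JordanLabel.cell : (e : JordanLabel 𝕜) → Matrix (Fin e.width) (Fin e.width) 𝕜
  | .scalar a => !![a]
  | .nonreal a b _ _ => !![(a : 𝕜), (b : 𝕜); -(b : 𝕜), (a : 𝕜)]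

/-- The Jordan block with `s` diagonal cells, partitioned into `s²` cells: the cell of `e` on the
diagonal, identity cells just above it, zero cells elsewhere. Its size is `s * e.width`. -/
def jordanBlock (e : JordanLabel 𝕜) (s : ℕ) :
    Matrix (Fin s × Fin e.width) (Fin s × Fin e.width) 𝕜 :=
  fun x y =>
    if x.1 = y.1 then e.cell x.2 y.2
    else if x.1.val + 1 = y.1.val then (1 : Matrix (Fin e.width) (Fin e.width) 𝕜) x.2 y.2
    else 0

/-- The index type of `phi e s`. -/
abbrev PhiIndex (e : JordanLabel 𝕜) {d : ℕ} (s : Fin d → ℕ) : Type :=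
  Σ j : Fin d, Fin (s j) × Fin e.width

/-- The direct sum `Φ(e)` of the Jordan blocks with label `e` and `s 0, s 1, …` cells. -/
def phi (e : JordanLabel 𝕜) {d : ℕ} (s : Fin d → ℕ) : Matrix (PhiIndex e s) (PhiIndex e s) 𝕜 :=
  blockDiagonal' fun j => jordanBlock e (s j)

/-- The places of the stars in a `p × q` block `H` (with `p = s * w`, `q = s' * w'`): the first
column if `p ≤ q`, the last row if `p > q`. -/
def starH {s w s' w' : ℕ} (x : Fin s × Fin w) (y : Fin s' × Fin w') : Prop :=
  if s * w ≤ s' * w' then y.1.val = 0 ∧ y.2.val = 0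
  else x.1.val + 1 = s ∧ x.2.val + 1 = w

/-- The places of the stars in the block matrix `ℋ = [H_{ij}]`, partitioned as `phi e s`. -/
def starPhi (e : JordanLabel 𝕜) {d : ℕ} (s : Fin d → ℕ) (x y : PhiIndex e s) : Prop :=
  starH x.2 y.2

/-- The data of a Jordan canonical matrix `⊕ᵢ Φ(λᵢ)` over `𝕜`, with distinct `λᵢ` and with the
Jordan blocks of each `Φ(λᵢ)` in order of nonincreasing size. -/
structure JordanData (𝕜 : Type) [RCLike 𝕜] where
  num : ℕ
  label : Fin num → JordanLabel 𝕜
  label_injective : Function.Injective label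
  blocks : Fin num → ℕ
  blocks_pos : ∀ i, 1 ≤ blocks i
  size : ∀ i, Fin (blocks i) → ℕ
  size_pos : ∀ i j, 1 ≤ size i j
  size_antitone : ∀ i, Antitone (size i)

namespace JordanData

/-- The index type of the Jordan canonical matrix. -/
abbrev Index (c : JordanData 𝕜) : Type := Σ i : Fin c.num, PhiIndex (c.label i) (c.size i)

/-- The Jordan canonical matrix `⊕ᵢ Φ(λᵢ)`. -/
def matrix (c : JordanData 𝕜) : Matrix c.Index c.Index 𝕜 :=
  blockDiagonal' fun i => phi (c.label i) (c.size i)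

/-- The places of the stars in `⊕ᵢ ℋᵢ`. -/
def star (c : JordanData 𝕜) (x y : c.Index) : Prop :=
  x.1 = y.1 ∧ starH x.2.2 y.2.2

end JordanData

/-! ### Canonical pairs -/

/-- The `r × (r - 1)` matrix `F_r`. -/
def F (𝕜 : Type) [RCLike 𝕜] (r : ℕ) : Matrix (Fin r) (Fin (r - 1)) 𝕜 :=
  fun i j => if i.val = j.val then 1 else 0

/-- The `r × (r - 1)` matrix `K_r`. -/
def K (𝕜 : Type) [RCLike 𝕜] (r : ℕ) : Matrix (Fin r) (Fin (r - 1)) 𝕜 :=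
  fun i j => if i.val = j.val + 1 then 1 else 0

/-- The direct sum of two rectangular matrices. -/
abbrev dirSum {R K R' K' : Type} (M : Matrix R K 𝕜) (N : Matrix R' K' 𝕜) :
    Matrix (R ⊕ R') (K ⊕ K') 𝕜 :=
  fromBlocks M 0 0 N

section Pairs

variable {l r : ℕ} (p : Fin l → ℕ) (q : Fin r → ℕ) (I J : Type)

/-- Row indices of `⊕ᵢ (F_{pᵢ}, K_{pᵢ}) ⊕ (1, C) ⊕ (D, 1) ⊕ ⊕ⱼ (F_{qⱼ}ᵀ, K_{qⱼ}ᵀ)`, where `C` is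
indexed by `I` and `D` by `J`. -/
abbrev Rows : Type := (Σ i, Fin (p i)) ⊕ (I ⊕ (J ⊕ (Σ j, Fin (q j - 1))))

/-- Column indices of `⊕ᵢ (F_{pᵢ}, K_{pᵢ}) ⊕ (1, C) ⊕ (D, 1) ⊕ ⊕ⱼ (F_{qⱼ}ᵀ, K_{qⱼ}ᵀ)`. -/
abbrev Cols : Type := (Σ i, Fin (p i - 1)) ⊕ (I ⊕ (J ⊕ (Σ j, Fin (q j))))

variable {I J}

/-- The first matrix of `⊕ᵢ (F_{pᵢ}, K_{pᵢ}) ⊕ (1, C) ⊕ (D, 1) ⊕ ⊕ⱼ (F_{qⱼ}ᵀ, K_{qⱼ}ᵀ)`. -/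
def pencilA [DecidableEq I] (D : Matrix J J 𝕜) : Matrix (Rows p q I J) (Cols p q I J) 𝕜 :=
  dirSum (blockDiagonal' fun i => F 𝕜 (p i))
    (dirSum (1 : Matrix I I 𝕜) (dirSum D (blockDiagonal' fun j => (F 𝕜 (q j))ᵀ)))

/-- The second matrix of `⊕ᵢ (F_{pᵢ}, K_{pᵢ}) ⊕ (1, C) ⊕ (D, 1) ⊕ ⊕ⱼ (F_{qⱼ}ᵀ, K_{qⱼ}ᵀ)`. -/
def pencilB [DecidableEq J] (C : Matrix I I 𝕜) : Matrix (Rows p q I J) (Cols p q I J) 𝕜 :=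
  dirSum (blockDiagonal' fun i => K 𝕜 (p i))
    (dirSum C (dirSum (1 : Matrix J J 𝕜) (blockDiagonal' fun j => (K 𝕜 (q j))ᵀ)))

end Pairs

/-! ### The places of the stars in the deformed pair -/

/-- `0^↑`: stars in the first row. -/
def starUp {a : ℕ} {β : Type} (x : Fin a) (_ : β) : Prop := x.val = 0

/-- `0^↓`: stars in the last row. -/
def starDown {a : ℕ} {β : Type} (x : Fin a) (_ : β) : Prop := x.val + 1 = a

/-- `0^←`: stars in the first column. -/
def starLeft {α : Type} {b : ℕ} (_ : α) (y : Fin b) : Prop := y.val = 0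

/-- `0^→`: stars in the last column. -/
def starRight {α : Type} {b : ℕ} (_ : α) (y : Fin b) : Prop := y.val + 1 = b

/-- `Z` of size `a × b`: stars at the first `max (b - a) 0` entries of the first row. -/
def starZ {a b : ℕ} (x : Fin a) (y : Fin b) : Prop := x.val = 0 ∧ y.val < b - a

section Pairs

variable {l r : ℕ} (p : Fin l → ℕ) (q : Fin r → ℕ) (I J : Type)

/-- The stars of the first matrix outside the block of `D`: `0^↓` in the rows of each `F_{pᵢ}`
and the columns of `D`; `0^→` in the rows of the `F_{pᵢ}`, and in the rows of `D`, and the columns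
of each `F_{qⱼ}ᵀ`. -/
def starA : Rows p q I J → Cols p q I J → Prop
  | .inl ⟨_, x⟩, .inr (.inr (.inl y)) => starDown x y
  | .inl x, .inr (.inr (.inr ⟨_, y⟩)) => starRight x y
  | .inr (.inr (.inl x)), .inr (.inr (.inr ⟨_, y⟩)) => starRight x y
  | _, _ => False

/-- The stars of the second matrix outside the block of `C`: `Z` in the rows of `K_{pᵢ}` and the
columns of `K_{pᵢ'}` for `i < i'`; `0^↑` in the rows of each `K_{pᵢ}` and the columns of `C`, and
the columns of the `K_{qⱼ}ᵀ`; `0^←` in the rows of `C` and the columns of each `K_{qⱼ}ᵀ`; `Zᵀ` in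
the rows of `K_{qⱼ}ᵀ` and the columns of `K_{qⱼ'}ᵀ` for `j < j'`. -/
def starB : Rows p q I J → Cols p q I J → Prop
  | .inl ⟨i, x⟩, .inl ⟨i', y⟩ => i < i' ∧ starZ x y
  | .inl ⟨_, x⟩, .inr (.inl y) => starUp x y
  | .inl ⟨_, x⟩, .inr (.inr (.inr y)) => starUp x y
  | .inr (.inl x), .inr (.inr (.inr ⟨_, y⟩)) => starLeft x y
  | .inr (.inr (.inr ⟨j, x⟩)), .inr (.inr (.inr ⟨j', y⟩)) => j < j' ∧ starZ y x
  | _, _ => False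

/-- The independent parameters of the deformed pair: those of the deformation of `C` (indexed by
`ιC`), those of the deformation of `D` (indexed by `ιD`), and the stars of the two matrices. -/
abbrev Params (ιC ιD : Type) : Type :=
  (ιC ⊕ ιD) ⊕ (Stars (starA p q I J) ⊕ Stars (starB p q I J))

variable {I J} {ιC ιD : Type}

/-- The first matrix of the deformed pair, with the deformation `D'` in place of `D`. -/
def deformA [DecidableEq I] (D' : (ιD → 𝕜) → Matrix J J 𝕜) (t : Params p q I J ιC ιD → 𝕜) :
    Matrix (Rows p q I J) (Cols p q I J) 𝕜 :=
  pencilA p q (D' fun k => t (.inl (.inr k))) +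
    starMatrix (starA p q I J) fun k => t (.inr (.inl k))

/-- The second matrix of the deformed pair, with the deformation `C'` in place of `C`. -/
def deformB [DecidableEq J] (C' : (ιC → 𝕜) → Matrix I I 𝕜) (t : Params p q I J ιC ιD → 𝕜) :
    Matrix (Rows p q I J) (Cols p q I J) 𝕜 :=
  pencilB p q (C' fun k => t (.inl (.inl k))) +
    starMatrix (starB p q I J) fun k => t (.inr (.inr k))

end Pairs

end PencilDeformation

end

noncomputable section

namespace PencilDeformation

open Matrix Filter Topology

/-! The theorem is reduced to linear algebra and then solved block by block. Changes of bases move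
`A` in the directions `X_j A_α - A_α X_i`, the range of `tangent A`. By the analytic inverse
function theorem a deformation is versal as soon as its derivative spans a supplement of this range;
testing versality on the lines `A + t y` gives the converse. So the least number of parameters is
the codimension of the range, and parameters placed at distinct entries form a simplest miniversal
deformation exactly when the coordinate subspace of these entries is a complement of the range
(`isSimplestMiniversal_iff`). In particular an arbitrary choice of `C'` and `D'` enters only through
the positions of its parameters.

For a pair, the range consists of the pairs `(S A - A R, S B - B R)`. Since `A` and `B` are block
diagonal, the blocks of `S` and `R` enter independent systems, one for each ordered pair of
summands, and being a complement may be checked block by block (`IsComplementary`). When neither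
summand is a regular one, the system consists of two-term relations along diagonals or
antidiagonals; stars stand where a chain of relations is overdetermined. Next to `(1, C)` or `(D,
1)` the first or second equation eliminates `R`, and what is left is a recurrence on columns, or on
rows after transposition. The blocks `(C, D)` and `(D, C)` need no stars because `D` is nilpotent.
The blocks `(C, C)` and `(D, D)` are the similarity problem, settled by the hypotheses on `C'` and
`D'`.

For the explicit deformations of `C` and `D`, Jordan blocks are treated as arrays of cells, on which
the commutator is a Sylvester operator `L` on each cell plus a shift. For different labels `L` is
invertible and no star is needed. For equal labels a projection onto the kernel of `L` separates a
pure shift problem, which carries the stars, from a part where `L` is invertible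
(`IsCellComplement.exists_array`, `IsCellComplement.eq_zero_of_array`). -/

/-! ### Analytic preliminaries -/

theorem exists_analyticAt_rightInverse {𝕜 E F : Type*} [RCLike 𝕜]
    [NormedAddCommGroup E] [NormedSpace 𝕜 E]
    [NormedAddCommGroup F] [NormedSpace 𝕜 F] [CompleteSpace F]
    {f : E → F} {a : E} (hf : AnalyticAt 𝕜 f a) (R : F →L[𝕜] E)
    (hR : ∀ y, fderiv 𝕜 f a (R y) = y) :
    ∃ g : F → E, AnalyticAt 𝕜 g (f a) ∧ g (f a) = a ∧ ∀ᶠ y in 𝓝 (f a), f (g y) = y := by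
  -- On the affine subspace through `a` parallel to the range of `R`, the map `f` has identity
  -- derivative, so the inverse function theorem applies to `f ∘ k`.
  set k : F → E := fun y => a + R (y - f a) with hk
  have hka : k (f a) = a := by simp [hk]
  have hkan : AnalyticAt 𝕜 k (f a) :=
    analyticAt_const.add ((R.analyticAt _).comp (analyticAt_id.sub analyticAt_const))
  have hkd : HasStrictFDerivAt k R (f a) := by
    have h := (R.hasStrictFDerivAt (x := f a)).add_const (a - R (f a))
    convert h using 2 with y
    simp only [hk, map_sub]
    abel
  have hh : AnalyticAt 𝕜 (f ∘ k) (f a) := AnalyticAt.comp (by rwa [hka]) hkan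
  have hd : HasStrictFDerivAt (f ∘ k) ((ContinuousLinearEquiv.refl 𝕜 F : F ≃L[𝕜] F) : F →L[𝕜] F)
      (f a) := by
    have h1 : HasStrictFDerivAt f (fderiv 𝕜 f a) (k (f a)) := by
      rw [hka]; exact hf.hasStrictFDerivAt
    have h2 := h1.comp (f a) hkd
    rwa [show (fderiv 𝕜 f a).comp R = ((ContinuousLinearEquiv.refl 𝕜 F : F ≃L[𝕜] F) : F →L[𝕜] F)
      from ContinuousLinearMap.ext hR] at h2
  set e := hd.toOpenPartialHomeomorph (f ∘ k) with he
  have hmem : f a ∈ e.source := hd.mem_toOpenPartialHomeomorph_source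
  have hea : e (f a) = f a := by
    change f (k (f a)) = f a
    rw [hka]
  have hsymm : AnalyticAt 𝕜 e.symm (f a) := by
    have := e.analyticAt_symm' (i := ContinuousLinearEquiv.refl 𝕜 F) hmem hh hd.hasFDerivAt.fderiv
    rwa [hea] at this
  have hes : e.symm (f a) = f a := by
    have := e.left_inv hmem
    rwa [hea] at this
  refine ⟨k ∘ e.symm, AnalyticAt.comp (by rwa [hes]) hsymm, by simp [hes, hka], ?_⟩
  have : e.target ∈ 𝓝 (f a) := by
    rw [← hea]; exact e.open_target.mem_nhds (e.map_source hmem)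
  filter_upwards [this] with y hy
  exact e.right_inv hy

theorem AnalyticAt.hasDerivAt_comp {𝕜 E F : Type*} [RCLike 𝕜]
    [NormedAddCommGroup E] [NormedSpace 𝕜 E] [NormedAddCommGroup F] [NormedSpace 𝕜 F]
    {f : E → F} {a : E} (hf : AnalyticAt 𝕜 f a) {c : 𝕜 → E} {c' : E} {x : 𝕜}
    (hc : HasDerivAt c c' x) (hx : c x = a) :
    HasDerivAt (fun s => f (c s)) (fderiv 𝕜 f a c') x := by
  subst hx
  exact hf.differentiableAt.hasFDerivAt.comp_hasDerivAt x hc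

section MatrixAnalytic

variable {𝕜 E : Type*} [RCLike 𝕜] [NormedAddCommGroup E] [NormedSpace 𝕜 E] {a : E}

theorem analyticAt_matrix_mul {l m n : Type*} [Fintype m] {M : E → Matrix l m 𝕜}
    {N : E → Matrix m n 𝕜} (hM : ∀ i j, AnalyticAt 𝕜 (fun t => M t i j) a)
    (hN : ∀ i j, AnalyticAt 𝕜 (fun t => N t i j) a) (i : l) (j : n) :
    AnalyticAt 𝕜 (fun t => (M t * N t) i j) a := by
  simp only [Matrix.mul_apply]
  exact Finset.analyticAt_fun_sum _ fun k _ => (hM i k).mul (hN k j)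

theorem analyticAt_matrix_det {n : Type*} [Fintype n] [DecidableEq n] {M : E → Matrix n n 𝕜}
    (hM : ∀ i j, AnalyticAt 𝕜 (fun t => M t i j) a) :
    AnalyticAt 𝕜 (fun t => (M t).det) a := by
  simp only [Matrix.det_apply']
  exact Finset.analyticAt_fun_sum _ fun σ _ =>
    analyticAt_const.mul (Finset.analyticAt_fun_prod _ fun k _ => hM _ _)

theorem analyticAt_matrix_inv {n : Type*} [Fintype n] [DecidableEq n] {M : E → Matrix n n 𝕜}
    (hM : ∀ i j, AnalyticAt 𝕜 (fun t => M t i j) a) (h0 : (M a).det ≠ 0) (i j : n) :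
    AnalyticAt 𝕜 (fun t => (M t)⁻¹ i j) a := by
  simp only [Matrix.inv_def, Matrix.smul_apply, Ring.inverse_eq_inv', smul_eq_mul,
    Matrix.adjugate_apply]
  refine ((analyticAt_matrix_det hM).inv h0).mul (analyticAt_matrix_det fun x y => ?_)
  by_cases hx : x = j
  · subst hx
    simpa using analyticAt_const
  · simpa [Matrix.updateRow_ne hx] using hM x y

end MatrixAnalytic

/-! ### Versality in terms of the tangent space -/

section Tangent

variable {V : Type} [Quiver.{0, 0} V] {n : V → Type} {𝕜 : Type} [RCLike 𝕜]
  [∀ v, Fintype (n v)]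

/-- The differential at the identity of the orbit map of `A` under change of bases. -/
def tangent (A : MatRep n 𝕜) : (∀ v, n v → n v → 𝕜) →ₗ[𝕜] (Entry n → 𝕜) where
  toFun X e := (Matrix.of (X e.tgt) * A e.src e.tgt e.arrow
    - A e.src e.tgt e.arrow * Matrix.of (X e.src)) e.row e.col
  map_add' X Y := by
    ext e
    simp only [Pi.add_apply, Matrix.sub_apply, Matrix.mul_apply, Matrix.of_apply, add_mul, mul_add,
      Finset.sum_add_distrib]
    ring
  map_smul' c X := by
    ext e
    simp only [Pi.smul_apply, Matrix.sub_apply, Matrix.mul_apply, Matrix.of_apply, smul_eq_mul,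
      RingHom.id_apply, mul_sub, Finset.mul_sum, mul_left_comm, mul_assoc]

theorem tangent_apply (A : MatRep n 𝕜) (X : ∀ v, n v → n v → 𝕜) (e : Entry n) :
    tangent A X e = (Matrix.of (X e.tgt) * A e.src e.tgt e.arrow
    - A e.src e.tgt e.arrow * Matrix.of (X e.src)) e.row e.col := rfl

/-- The relation is differentiated in the form `ℬ S = S 𝒜`, so that no derivative of an inverse
matrix is needed. -/
theorem eq_tangent_add_of_hasDerivAt [∀ v, DecidableEq (n v)]
    {S : 𝕜 → ∀ v, Matrix (n v) (n v) 𝕜} {S' : ∀ v, n v → n v → 𝕜}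
    {𝒜 ℬ : 𝕜 → MatRep n 𝕜} {a b : Entry n → 𝕜}
    (hS : ∀ v x y, HasDerivAt (fun s => S s v x y) (S' v x y) 0) (hS0 : ∀ v, S 0 v = 1)
    (h𝒜 : ∀ e, HasDerivAt (fun s => (𝒜 s).entry e) (a e) 0)
    (hℬ : ∀ e, HasDerivAt (fun s => (ℬ s).entry e) (b e) 0)
    (h : ∀ᶠ s in 𝓝 (0 : 𝕜), ∀ (i j : V) (α : i ⟶ j),
      ℬ s i j α = S s j * 𝒜 s i j α * (S s i)⁻¹) :
    b = tangent (𝒜 0) S' + a := by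
  ext ⟨i, j, α, x, y⟩
  have hdet : ContinuousAt (fun s => (S s i).det) 0 := by
    simp only [Matrix.det_apply']
    exact tendsto_finsetSum _ fun σ _ => tendsto_const_nhds.mul
      (tendsto_finsetProd _ fun k _ => (hS i _ _).continuousAt)
  have hne : ∀ᶠ s in 𝓝 (0 : 𝕜), (S s i).det ≠ 0 := hdet.eventually_ne (by simp [hS0])
  have h0 : ℬ 0 i j α = 𝒜 0 i j α := by simpa [hS0] using h.self_of_nhds i j α
  have key : (fun s => (ℬ s i j α * S s i) x y) =ᶠ[𝓝 0] fun s => (S s j * 𝒜 s i j α) x y := by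
    filter_upwards [h, hne] with s hs hs'
    rw [hs i j α, Matrix.mul_assoc, Matrix.nonsing_inv_mul _ (isUnit_iff_ne_zero.mpr hs'),
      Matrix.mul_one]
  have h1 : HasDerivAt (fun s => (ℬ s i j α * S s i) x y)
      (∑ k, (b ⟨i, j, α, x, k⟩ * S 0 i k y + ℬ 0 i j α x k * S' i k y)) 0 := by
    simp only [Matrix.mul_apply]
    exact HasDerivAt.fun_sum fun k _ => (hℬ ⟨i, j, α, x, k⟩).mul (hS i k y)
  have h2 : HasDerivAt (fun s => (S s j * 𝒜 s i j α) x y)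
      (∑ k, (S' j x k * 𝒜 0 i j α k y + S 0 j x k * a ⟨i, j, α, k, y⟩)) 0 := by
    simp only [Matrix.mul_apply]
    exact HasDerivAt.fun_sum fun k _ => (hS j x k).mul (h𝒜 ⟨i, j, α, k, y⟩)
  have h3 := h1.unique (h2.congr_of_eventuallyEq key)
  simp only [hS0, Finset.sum_add_distrib, Matrix.one_apply, mul_ite, mul_one, mul_zero, ite_mul,
    one_mul, zero_mul, Finset.sum_ite_eq, Finset.sum_ite_eq', Finset.mem_univ, if_true, h0] at h3
  simp only [Pi.add_apply, tangent_apply, Matrix.sub_apply, Matrix.mul_apply, Matrix.of_apply]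
  linear_combination h3

/-- The map `Ψ (X, t) = (1 + X) 𝒜(t) (1 + X)⁻¹` is a submersion at `0`. A local analytic right
inverse of it, composed with `ℬ`, yields the change of bases and the change of parameters at once.
-/
theorem isVersal_of_surjective [Fintype V] [∀ v, DecidableEq (n v)] [Fintype (Entry n)]
    {ι : Type} [Fintype ι] {A : MatRep n 𝕜} {𝒜 : (ι → 𝕜) → MatRep n 𝕜} (h𝒜 : IsDeformation A 𝒜)
    (h : ∀ y, ∃ X v, tangent A X + fderiv 𝕜 (fun t e => (𝒜 t).entry e) 0 v = y) :
    IsVersal A 𝒜 := by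
  have h𝒜a : AnalyticAt 𝕜 (fun t e => (𝒜 t).entry e) 0 := AnalyticAt.pi h𝒜.1
  set D := fderiv 𝕜 (fun t e => (𝒜 t).entry e) 0 with hD
  set S : (∀ v, n v → n v → 𝕜) × (ι → 𝕜) → ∀ v, Matrix (n v) (n v) 𝕜 :=
    fun z v => 1 + Matrix.of (z.1 v) with hS
  set Ψ : (∀ v, n v → n v → 𝕜) × (ι → 𝕜) → Entry n → 𝕜 := fun z e =>
    (S z e.tgt * 𝒜 z.2 e.src e.tgt e.arrow * (S z e.src)⁻¹) e.row e.col with hΨ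
  have hS0 : ∀ v, S 0 v = 1 := fun v => by
    ext x y; simp [hS]
  have hSan : ∀ v x y, AnalyticAt 𝕜 (fun z => S z v x y) 0 := fun v x y => by
    have h1 : AnalyticAt 𝕜 (fun z : (∀ v, n v → n v → 𝕜) × (ι → 𝕜) => z.1 v x y) 0 :=
      ((ContinuousLinearMap.proj (R := 𝕜) (φ := fun _ : n v => 𝕜) y).comp
        ((ContinuousLinearMap.proj (R := 𝕜) (φ := fun _ : n v => n v → 𝕜) x).comp
        ((ContinuousLinearMap.proj (R := 𝕜) (φ := fun v => n v → n v → 𝕜) v).comp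
        (ContinuousLinearMap.fst 𝕜 (∀ v, n v → n v → 𝕜) (ι → 𝕜))))).analyticAt 0
    exact analyticAt_const.add h1
  have hΨan : AnalyticAt 𝕜 Ψ 0 := by
    refine AnalyticAt.pi fun e => ?_
    refine analyticAt_matrix_mul (M := fun z => S z e.tgt * 𝒜 z.2 e.src e.tgt e.arrow)
      (N := fun z => (S z e.src)⁻¹) (fun i j => ?_) (fun i j => ?_) _ _
    · refine analyticAt_matrix_mul (M := fun z => S z e.tgt)
        (N := fun z => 𝒜 z.2 e.src e.tgt e.arrow) (hSan _) (fun k l => ?_) _ _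
      exact (h𝒜.1 ⟨e.src, e.tgt, e.arrow, k, l⟩).comp_of_eq analyticAt_snd rfl
    · exact analyticAt_matrix_inv (hSan _) (by simp [hS0]) _ _
  have hΨ0 : Ψ 0 = fun e => A.entry e := by
    ext e
    simp only [hΨ, hS0, inv_one, Matrix.one_mul, Matrix.mul_one, Prod.snd_zero, h𝒜.2]
    rfl
  -- The derivative is computed along the lines `s • (X, v)`, where `Ψ` is by definition equivalent
  -- to `𝒜 (s • v)`.
  have hderiv : ∀ z, fderiv 𝕜 Ψ 0 z = tangent A z.1 + D z.2 := by
    rintro ⟨X, v⟩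
    have hc1 : HasDerivAt (fun s : 𝕜 => s • (X, v)) (X, v) 0 := by
      simpa using (hasDerivAt_id (0 : 𝕜)).smul_const (X, v)
    have hc2 : HasDerivAt (fun s : 𝕜 => s • v) v 0 := by
      simpa using (hasDerivAt_id (0 : 𝕜)).smul_const v
    have h1 : HasDerivAt (fun s : 𝕜 => Ψ (s • (X, v))) (fderiv 𝕜 Ψ 0 (X, v)) 0 :=
      AnalyticAt.hasDerivAt_comp hΨan hc1 (zero_smul _ _)
    have h2 : HasDerivAt (fun s : 𝕜 => fun e => (𝒜 (s • v)).entry e) (D v) 0 :=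
      AnalyticAt.hasDerivAt_comp h𝒜a hc2 (zero_smul _ _)
    have := eq_tangent_add_of_hasDerivAt (S := fun s => S (s • (X, v))) (S' := X)
      (𝒜 := fun s => 𝒜 (s • v))
      (ℬ := fun s i j α => S (s • (X, v)) j * 𝒜 (s • v) i j α * (S (s • (X, v)) i)⁻¹)
      (a := D v) (b := fderiv 𝕜 Ψ 0 (X, v)) (fun w x y => ?_) (fun w => by simp [hS0])
      (hasDerivAt_pi.1 h2) (hasDerivAt_pi.1 h1) (Eventually.of_forall fun s i j α => rfl)
    · simpa [h𝒜.2] using this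
    · have h3 : HasDerivAt (fun s : 𝕜 => (1 : Matrix (n w) (n w) 𝕜) x y + s * X w x y)
          (X w x y) 0 := by
        simpa using ((hasDerivAt_id (0 : 𝕜)).mul_const (X w x y)).const_add
          ((1 : Matrix (n w) (n w) 𝕜) x y)
      exact h3
  obtain ⟨R, hR⟩ := LinearMap.exists_rightInverse_of_surjective
    (fderiv 𝕜 Ψ 0).toLinearMap (LinearMap.range_eq_top.2 fun y => by
      obtain ⟨X, v, hXv⟩ := h y
      exact ⟨(X, v), (hderiv (X, v)).trans hXv⟩)
  obtain ⟨g, hg, hg0, hgr⟩ := exists_analyticAt_rightInverse hΨan R.toContinuousLinearMap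
    fun y => LinearMap.congr_fun hR y
  refine ⟨h𝒜, fun m ℬ hℬ => ?_⟩
  have hℬa : AnalyticAt 𝕜 (fun t e => (ℬ t).entry e) 0 := AnalyticAt.pi hℬ.1
  have hℬ0 : (fun e => (ℬ 0).entry e) = Ψ 0 := by rw [hΨ0, hℬ.2]
  set γ : (Fin m → 𝕜) → (∀ v, n v → n v → 𝕜) × (ι → 𝕜) := fun t => g fun e => (ℬ t).entry e
    with hγ
  have hγa : AnalyticAt 𝕜 γ 0 := hg.comp_of_eq hℬa hℬ0
  have hγ0 : γ 0 = 0 := by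
    simp only [hγ]
    rw [hℬ0, hg0]
  refine ⟨fun t => (γ t).2, analyticAt_snd.comp hγa, by simp [hγ0], fun t => S (γ t),
    fun v x y => (hSan v x y).comp_of_eq hγa hγ0, fun v => by simp [hγ0, hS0], ?_⟩
  have hev : ∀ᶠ t in 𝓝 (0 : Fin m → 𝕜), Ψ (γ t) = fun e => (ℬ t).entry e := by
    have := hℬa.continuousAt.tendsto
    rw [hℬ0] at this
    exact this.eventually hgr
  filter_upwards [hev] with t ht i j α
  ext x y
  exact (congrFun ht ⟨i, j, α, x, y⟩).symm

/-- Versality is tested on the one-parameter deformation `A + t y`: differentiating the equivalence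
at `t = 0` decomposes `y`. -/
theorem IsVersal.surjective [∀ v, DecidableEq (n v)] [Fintype (Entry n)]
    {ι : Type} [Fintype ι] {A : MatRep n 𝕜} {𝒜 : (ι → 𝕜) → MatRep n 𝕜} (h : IsVersal A 𝒜)
    (y : Entry n → 𝕜) :
    ∃ X v, tangent A X + fderiv 𝕜 (fun t e => (𝒜 t).entry e) 0 v = y := by
  have h𝒜a : AnalyticAt 𝕜 (fun t e => (𝒜 t).entry e) 0 := AnalyticAt.pi h.1.1
  have hp : AnalyticAt 𝕜 (fun t : Fin 1 → 𝕜 => t 0) 0 := analyticAt_pi_iff.1 analyticAt_id 0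
  obtain ⟨φ, hφ, hφ0, S, hS, hS0, hev⟩ := h.2 1
    (fun t i j α => A i j α + t 0 • Matrix.of fun x z => y ⟨i, j, α, x, z⟩)
    ⟨fun e => analyticAt_const.add (hp.mul analyticAt_const), by
      ext i j α x z; simp⟩
  have hc : HasDerivAt (fun s : 𝕜 => fun _ : Fin 1 => s) (fun _ => 1) 0 :=
    hasDerivAt_pi.2 fun _ => hasDerivAt_id _
  have hc0 : (fun _ : Fin 1 => (0 : 𝕜)) = 0 := rfl
  have hφd : HasDerivAt (fun s : 𝕜 => φ fun _ => s) (fderiv 𝕜 φ 0 fun _ => 1) 0 :=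
    AnalyticAt.hasDerivAt_comp hφ hc hc0
  have h𝒜d : HasDerivAt (fun s : 𝕜 => fun e => (𝒜 (φ fun _ => s)).entry e)
      (fderiv 𝕜 (fun t e => (𝒜 t).entry e) 0 (fderiv 𝕜 φ 0 fun _ => 1)) 0 :=
    AnalyticAt.hasDerivAt_comp h𝒜a hφd hφ0
  have hSd : ∀ v x z, HasDerivAt (fun s : 𝕜 => S (fun _ => s) v x z)
      (fderiv 𝕜 (fun t => S t v x z) 0 fun _ => 1) 0 := fun v x z =>
    AnalyticAt.hasDerivAt_comp (hS v x z) hc hc0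
  have hℬd : ∀ e : Entry n, HasDerivAt (fun s : 𝕜 => A.entry e + s * y e) (y e) 0 := fun e => by
    simpa using ((hasDerivAt_id (0 : 𝕜)).mul_const (y e)).const_add (A.entry e)
  have hev' := (hc.continuousAt.tendsto).eventually hev
  have := eq_tangent_add_of_hasDerivAt (S := fun s => S fun _ => s)
    (𝒜 := fun s => 𝒜 (φ fun _ => s))
    (ℬ := fun s i j α => A i j α + s • Matrix.of fun x z => y ⟨i, j, α, x, z⟩) (b := y)
    hSd hS0 (hasDerivAt_pi.1 h𝒜d) hℬd hev'
  rw [hc0, hφ0, h.1.2] at this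
  exact ⟨_, _, this.symm⟩

end Tangent

/-! ### Simplest miniversal deformations as coordinate complements -/

section Transversal

set_option linter.unusedSectionVars false

variable {V : Type} [Quiver.{0, 0} V] {n : V → Type} {𝕜 : Type} [RCLike 𝕜]
  [∀ v, Fintype (n v)]

/-- The coordinate subspace of the positions `P` is a complement of the tangent space at `A` to
its isomorphism class. -/
def IsTransversal (A : MatRep n 𝕜) (P : Set (Entry n)) : Prop :=
  (∀ y : Entry n → 𝕜, ∃ X, ∀ e ∉ P, tangent A X e = y e) ∧
  ∀ X, (∀ e ∉ P, tangent A X e = 0) → tangent A X = 0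

theorem IsVersal.finrank_le [∀ v, DecidableEq (n v)] [Fintype (Entry n)]
    {ι : Type} [Fintype ι] {A : MatRep n 𝕜} {𝒜 : (ι → 𝕜) → MatRep n 𝕜} (h : IsVersal A 𝒜) :
    Module.finrank 𝕜 (Entry n → 𝕜) ≤
      Module.finrank 𝕜 (LinearMap.range (tangent A)) + Fintype.card ι := by
  set D := (fderiv 𝕜 (fun t e => (𝒜 t).entry e) 0).toLinearMap with hD
  have hsup : LinearMap.range (tangent A) ⊔ LinearMap.range D = ⊤ := by
    refine eq_top_iff.2 fun y _ => ?_
    obtain ⟨X, v, hy⟩ := h.surjective y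
    rw [← hy]
    exact Submodule.add_mem_sup ⟨X, rfl⟩ ⟨v, rfl⟩
  have h1 := Submodule.finrank_add_le_finrank_add_finrank (LinearMap.range (tangent A))
    (LinearMap.range D)
  have h2 : Module.finrank 𝕜 (LinearMap.range D) ≤ Fintype.card ι := by
    simpa using LinearMap.finrank_range_le D
  rw [hsup, finrank_top] at h1
  omega

/-- The affine deformation of `A` in the directions of the range of `L`. -/
def linearDeformation {ι : Type} (A : MatRep n 𝕜) (L : (ι → 𝕜) →ₗ[𝕜] (Entry n → 𝕜))
    (t : ι → 𝕜) : MatRep n 𝕜 :=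
  fun i j α => A i j α + Matrix.of fun x y => L t ⟨i, j, α, x, y⟩

theorem linearDeformation_entry {ι : Type} (A : MatRep n 𝕜) (L : (ι → 𝕜) →ₗ[𝕜] (Entry n → 𝕜))
    (t : ι → 𝕜) (e : Entry n) : (linearDeformation A L t).entry e = A.entry e + L t e := rfl

theorem hasFDerivAt_linearDeformation [Fintype (Entry n)] {ι : Type} [Fintype ι] (A : MatRep n 𝕜)
    (L : (ι → 𝕜) →ₗ[𝕜] (Entry n → 𝕜)) :
    HasFDerivAt (fun t e => (linearDeformation A L t).entry e) L.toContinuousLinearMap 0 :=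
  (L.toContinuousLinearMap.hasFDerivAt (x := 0)).const_add (fun e => A.entry e)

theorem isDeformation_linearDeformation [Fintype (Entry n)] {ι : Type} [Fintype ι] (A : MatRep n 𝕜)
    (L : (ι → 𝕜) →ₗ[𝕜] (Entry n → 𝕜)) : IsDeformation A (linearDeformation A L) := by
  refine ⟨fun e => analyticAt_const.add ?_, ?_⟩
  · exact analyticAt_pi_iff.1 (L.toContinuousLinearMap.analyticAt 0) e
  · ext i j α x y
    simp [linearDeformation]

theorem isVersal_linearDeformation [Fintype V] [∀ v, DecidableEq (n v)] [Fintype (Entry n)]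
    {ι : Type} [Fintype ι] (A : MatRep n 𝕜) (L : (ι → 𝕜) →ₗ[𝕜] (Entry n → 𝕜))
    (h : LinearMap.range (tangent A) ⊔ LinearMap.range L = ⊤) :
    IsVersal A (linearDeformation A L) := by
  refine isVersal_of_surjective (isDeformation_linearDeformation A L) fun y => ?_
  obtain ⟨_, ⟨X, rfl⟩, _, ⟨v, rfl⟩, hy⟩ := Submodule.mem_sup.1 (h ▸ Submodule.mem_top (x := y))
  refine ⟨X, v, ?_⟩
  rw [(hasFDerivAt_linearDeformation A L).fderiv]
  exact hy

/-- A basis of any complement of the tangent space gives the directions. With `IsVersal.finrank_le`,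
the least number of parameters is the codimension. -/
theorem exists_isVersal [Fintype V] [∀ v, DecidableEq (n v)] [Fintype (Entry n)]
    (A : MatRep n 𝕜) : ∃ (m : ℕ) (ℬ : (Fin m → 𝕜) → MatRep n 𝕜), IsVersal A ℬ ∧
      Module.finrank 𝕜 (LinearMap.range (tangent A)) + m = Module.finrank 𝕜 (Entry n → 𝕜) := by
  obtain ⟨W, hW⟩ := (LinearMap.range (tangent A)).exists_isCompl
  refine ⟨Module.finrank 𝕜 W, linearDeformation A
    (W.subtype ∘ₗ (Module.finBasis 𝕜 W).equivFun.symm.toLinearMap), ?_,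
    Submodule.finrank_add_eq_of_isCompl hW⟩
  refine isVersal_linearDeformation _ _ ?_
  rw [LinearMap.range_comp_of_range_eq_top _ (LinearEquiv.range _), Submodule.range_subtype]
  exact hW.sup_eq_top

variable {ι : Type}

/-- The linear map that puts parameters at given positions. -/
def placement (𝕜 : Type) [RCLike 𝕜] (pos : ι → Entry n) : (ι → 𝕜) →ₗ[𝕜] (Entry n → 𝕜) :=
  Function.ExtendByZero.linearMap 𝕜 pos

theorem placement_apply {pos : ι → Entry n} (hpos : Function.Injective pos) (t : ι → 𝕜) (k : ι) :
    placement 𝕜 pos t (pos k) = t k := hpos.extend_apply _ _ _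

theorem placement_apply_of_notMem {pos : ι → Entry n} (t : ι → 𝕜) {e : Entry n}
    (he : e ∉ Set.range pos) : placement 𝕜 pos t e = 0 := Function.extend_apply' _ _ _ he

theorem eq_linearDeformation_iff {A : MatRep n 𝕜} {𝒜 : (ι → 𝕜) → MatRep n 𝕜} {pos : ι → Entry n}
    (hpos : Function.Injective pos) : 𝒜 = linearDeformation A (placement 𝕜 pos) ↔ ∀ t : ι → 𝕜,
      (∀ k, (𝒜 t).entry (pos k) = A.entry (pos k) + t k) ∧
      (∀ e, e ∉ Set.range pos → (𝒜 t).entry e = A.entry e) := by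
  constructor
  · rintro rfl t
    refine ⟨fun k => ?_, fun e he => ?_⟩
    · rw [linearDeformation_entry, placement_apply hpos]
    · rw [linearDeformation_entry, placement_apply_of_notMem t he, add_zero]
  · intro h
    funext t
    ext i j α x y
    change (𝒜 t).entry ⟨i, j, α, x, y⟩ = (linearDeformation _ _ t).entry ⟨i, j, α, x, y⟩
    by_cases he : (⟨i, j, α, x, y⟩ : Entry n) ∈ Set.range pos
    · obtain ⟨k, hk⟩ := he
      rw [← hk, (h t).1, linearDeformation_entry, placement_apply hpos]
    · rw [(h t).2 _ he, linearDeformation_entry, placement_apply_of_notMem t he, add_zero]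

theorem isTransversal_range_iff {A : MatRep n 𝕜} {pos : ι → Entry n}
    (hpos : Function.Injective pos) : IsTransversal A (Set.range pos) ↔
      IsCompl (LinearMap.range (tangent A)) (LinearMap.range (placement 𝕜 pos)) := by
  have hmem : ∀ y : Entry n → 𝕜, (∀ e ∉ Set.range pos, y e = 0) →
      y ∈ LinearMap.range (placement 𝕜 pos) := fun y hy => ⟨fun k => y (pos k), by
    ext e
    by_cases he : e ∈ Set.range pos
    · obtain ⟨k, rfl⟩ := he
      rw [placement_apply hpos]
    · rw [placement_apply_of_notMem _ he, hy e he]⟩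
  rw [isCompl_iff, Submodule.disjoint_def, codisjoint_iff]
  constructor
  · rintro ⟨h1, h2⟩
    refine ⟨?_, eq_top_iff.2 fun y _ => ?_⟩
    · rintro _ ⟨X, rfl⟩ ⟨t, ht⟩
      exact h2 X fun e he => by rw [← ht, placement_apply_of_notMem t he]
    · obtain ⟨X, hX⟩ := h1 y
      refine Submodule.mem_sup.2 ⟨_, ⟨X, rfl⟩, y - tangent A X, hmem _ fun e he => ?_,
        add_sub_cancel _ _⟩
      rw [Pi.sub_apply, hX e he, sub_self]
  · rintro ⟨h1, h2⟩
    refine ⟨fun y => ?_, fun X hX => h1 _ ⟨X, rfl⟩ (hmem _ hX)⟩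
    obtain ⟨_, ⟨X, rfl⟩, _, ⟨t, rfl⟩, hy⟩ := Submodule.mem_sup.1 (h2 ▸ Submodule.mem_top (x := y))
    refine ⟨X, fun e he => ?_⟩
    rw [← hy, Pi.add_apply, placement_apply_of_notMem t he, add_zero]

/-- Versality makes the coordinate subspace and the tangent space span everything, and minimality
bounds the number of parameters by the codimension, so the sum is direct. Conversely, a complement
has exactly the dimension that every versal deformation needs. -/
theorem isSimplestMiniversal_iff [Fintype V] [∀ v, DecidableEq (n v)] [Fintype (Entry n)]
    [Fintype ι] {A : MatRep n 𝕜} {𝒜 : (ι → 𝕜) → MatRep n 𝕜} :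
    IsSimplestMiniversal A 𝒜 ↔ ∃ pos : ι → Entry n, Function.Injective pos ∧
      (∀ t : ι → 𝕜, (∀ k, (𝒜 t).entry (pos k) = A.entry (pos k) + t k) ∧
        (∀ e, e ∉ Set.range pos → (𝒜 t).entry e = A.entry e)) ∧
      IsTransversal A (Set.range pos) := by
  constructor
  · rintro ⟨⟨hv, hmin⟩, pos, hpos, h𝒜⟩
    refine ⟨pos, hpos, h𝒜, (isTransversal_range_iff hpos).2 ?_⟩
    have hsup : LinearMap.range (tangent A) ⊔ LinearMap.range (placement 𝕜 pos) = ⊤ := by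
      refine eq_top_iff.2 fun y _ => ?_
      obtain ⟨X, v, hy⟩ := hv.surjective y
      rw [(eq_linearDeformation_iff hpos).2 h𝒜,
        (hasFDerivAt_linearDeformation A (placement 𝕜 pos)).fderiv] at hy
      rw [← hy]
      exact Submodule.add_mem_sup ⟨X, rfl⟩ ⟨v, rfl⟩
    refine ⟨?_, codisjoint_iff.2 hsup⟩
    obtain ⟨m, ℬ, hℬ, hm⟩ := exists_isVersal A
    have hcard := hmin m ℬ hℬ
    have h1 := Submodule.finrank_sup_add_finrank_inf_eq (LinearMap.range (tangent A))
      (LinearMap.range (placement 𝕜 pos))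
    have h2 : Module.finrank 𝕜 (LinearMap.range (placement 𝕜 pos)) ≤ Fintype.card ι := by
      simpa using LinearMap.finrank_range_le (placement 𝕜 pos)
    rw [hsup, finrank_top] at h1
    rw [disjoint_iff, ← Submodule.finrank_eq_zero (R := 𝕜)]
    omega
  · rintro ⟨pos, hpos, h𝒜, htr⟩
    refine ⟨⟨?_, fun m ℬ hℬ => ?_⟩, pos, hpos, h𝒜⟩
    · rw [(eq_linearDeformation_iff hpos).2 h𝒜]
      exact isVersal_linearDeformation _ _ ((isTransversal_range_iff hpos).1 htr).sup_eq_top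
    · have h1 := Submodule.finrank_add_eq_of_isCompl ((isTransversal_range_iff hpos).1 htr)
      have h2 : Module.finrank 𝕜 (LinearMap.range (placement 𝕜 pos)) = Fintype.card ι := by
        rw [LinearMap.finrank_range_of_inj, Module.finrank_fintype_fun_eq_card]
        intro t t' h
        ext k
        rw [← placement_apply hpos t, h, placement_apply hpos]
      have h3 := hℬ.finrank_le
      rw [Fintype.card_fin] at h3
      omega

end Transversal

/-! ### Complements for a pair of summands and their direct sums -/

section Complementary

variable {𝕜 : Type} [RCLike 𝕜]
  {m₁ n₁ m₂ n₂ m₁' n₁' m₂' n₂' : Type} [Fintype n₁] [Fintype m₂]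
  [Fintype n₁'] [Fintype m₂']

/-- The pairs of matrices supported on `P` and `Q` form a complement of the space of the pairs
`(S * A₂ - A₁ * R, S * B₂ - B₁ * R)`. -/
def IsComplementary (A₁ B₁ : Matrix m₁ n₁ 𝕜) (A₂ B₂ : Matrix m₂ n₂ 𝕜) (P Q : m₁ → n₂ → Prop) :
    Prop :=
  (∀ M N : Matrix m₁ n₂ 𝕜, ∃ (S : Matrix m₁ m₂ 𝕜) (R : Matrix n₁ n₂ 𝕜),
    (∀ a b, ¬ P a b → (S * A₂ - A₁ * R) a b = M a b) ∧
    (∀ a b, ¬ Q a b → (S * B₂ - B₁ * R) a b = N a b)) ∧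
  ∀ (S : Matrix m₁ m₂ 𝕜) (R : Matrix n₁ n₂ 𝕜),
    (∀ a b, ¬ P a b → (S * A₂ - A₁ * R) a b = 0) →
    (∀ a b, ¬ Q a b → (S * B₂ - B₁ * R) a b = 0) →
    S * A₂ - A₁ * R = 0 ∧ S * B₂ - B₁ * R = 0

variable {A₁ B₁ : Matrix m₁ n₁ 𝕜} {A₂ B₂ : Matrix m₂ n₂ 𝕜} {P Q : m₁ → n₂ → Prop}

theorem IsComplementary.congr (h : IsComplementary A₁ B₁ A₂ B₂ P Q) {P' Q' : m₁ → n₂ → Prop}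
    (hP : ∀ a b, P' a b ↔ P a b) (hQ : ∀ a b, Q' a b ↔ Q a b) :
    IsComplementary A₁ B₁ A₂ B₂ P' Q' := by
  have hP' : P' = P := by ext a b; exact hP a b
  have hQ' : Q' = Q := by ext a b; exact hQ a b
  rwa [hP', hQ']

theorem IsComplementary.swap (h : IsComplementary A₁ B₁ A₂ B₂ P Q) :
    IsComplementary B₁ A₁ B₂ A₂ Q P := by
  refine ⟨fun M N => ?_, fun S R hS hR => (h.2 S R hR hS).symm⟩
  obtain ⟨S, R, h1, h2⟩ := h.1 N M
  exact ⟨S, R, h2, h1⟩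

theorem IsComplementary.transpose (h : IsComplementary A₁ B₁ A₂ B₂ P Q) :
    IsComplementary A₂ᵀ B₂ᵀ A₁ᵀ B₁ᵀ (fun b a => P a b) (fun b a => Q a b) := by
  have key : ∀ (A₁ : Matrix m₁ n₁ 𝕜) (A₂ : Matrix m₂ n₂ 𝕜) (S : Matrix m₁ m₂ 𝕜)
      (R : Matrix n₁ n₂ 𝕜), -Rᵀ * A₁ᵀ - A₂ᵀ * -Sᵀ = (S * A₂ - A₁ * R)ᵀ := fun A₁ A₂ S R => by
    rw [Matrix.transpose_sub, Matrix.transpose_mul, Matrix.transpose_mul, Matrix.neg_mul,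
      Matrix.mul_neg]
    abel
  constructor
  · intro M N
    obtain ⟨S, R, h1, h2⟩ := h.1 Mᵀ Nᵀ
    -- Transposition exchanges the roles of `S` and `R`; the signs restore the order of the
    -- difference.
    refine ⟨-Rᵀ, -Sᵀ, fun a b hab => ?_, fun a b hab => ?_⟩
    · rw [key]; exact h1 b a hab
    · rw [key]; exact h2 b a hab
  · intro S R h1 h2
    have hS : S = -(-Sᵀ)ᵀ := by simp
    have hR : R = -(-Rᵀ)ᵀ := by simp
    rw [hS, hR] at h1 h2 ⊢
    rw [key] at h1 h2 ⊢
    rw [key, Matrix.transpose_eq_zero, Matrix.transpose_eq_zero]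
    exact h.2 _ _ (fun a b => h1 b a) (fun a b => h2 b a)

theorem IsComplementary.reindex (h : IsComplementary A₁ B₁ A₂ B₂ P Q) (e : m₂' ≃ m₂)
    (f : n₂' ≃ n₂) : IsComplementary A₁ B₁ (A₂.submatrix e f) (B₂.submatrix e f)
      (fun a b => P a (f b)) (fun a b => Q a (f b)) := by
  have key : ∀ (A₁ : Matrix m₁ n₁ 𝕜) (A₂ : Matrix m₂ n₂ 𝕜) (S : Matrix m₁ m₂ 𝕜)
      (R : Matrix n₁ n₂ 𝕜), S.submatrix id e * A₂.submatrix e f - A₁ * R.submatrix id f =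
        (S * A₂ - A₁ * R).submatrix id f := fun A₁ A₂ S R => by
    ext a b
    simp only [Matrix.sub_apply, Matrix.submatrix_apply, Matrix.mul_apply, id]
    rw [e.sum_comp fun k => S a k * A₂ k (f b)]
  constructor
  · intro M N
    obtain ⟨S, R, h1, h2⟩ := h.1 (M.submatrix id f.symm) (N.submatrix id f.symm)
    refine ⟨S.submatrix id e, R.submatrix id f, fun a b hab => ?_, fun a b hab => ?_⟩
    · rw [key, Matrix.submatrix_apply, id, h1 a _ hab]; simp
    · rw [key, Matrix.submatrix_apply, id, h2 a _ hab]; simp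
  · intro S R h1 h2
    have hS : S = (S.submatrix id e.symm).submatrix id e := by simp
    have hR : R = (R.submatrix id f.symm).submatrix id f := by simp
    rw [hS, hR] at h1 h2 ⊢
    rw [key] at h1 h2 ⊢
    rw [key]
    obtain ⟨h3, h4⟩ := h.2 (S.submatrix id e.symm) (R.submatrix id f.symm)
      (fun a b hab => by simpa using h1 a (f.symm b) (by simpa using hab))
      (fun a b hab => by simpa using h2 a (f.symm b) (by simpa using hab))
    rw [h3, h4]
    exact ⟨rfl, rfl⟩

/-- The row blocks decouple: those of `S A₂ - (A₁ ⊕ A₁') R` involve disjoint parts of `S` and `R`.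
The versions for columns follow by transposition. -/
theorem IsComplementary.dirSum_left {A₁' B₁' : Matrix m₁' n₁' 𝕜} {P Q : m₁ ⊕ m₁' → n₂ → Prop}
    (h : IsComplementary A₁ B₁ A₂ B₂ (fun a => P (.inl a)) (fun a => Q (.inl a)))
    (h' : IsComplementary A₁' B₁' A₂ B₂ (fun a => P (.inr a)) (fun a => Q (.inr a))) :
    IsComplementary (dirSum A₁ A₁') (dirSum B₁ B₁') A₂ B₂ P Q := by
  have key : ∀ (A₁ : Matrix m₁ n₁ 𝕜) (A₁' : Matrix m₁' n₁' 𝕜) (A₂ : Matrix m₂ n₂ 𝕜)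
      (S : Matrix (m₁ ⊕ m₁') m₂ 𝕜) (R : Matrix (n₁ ⊕ n₁') n₂ 𝕜),
      S * A₂ - dirSum A₁ A₁' * R = fromRows (S.toRows₁ * A₂ - A₁ * R.toRows₁)
        (S.toRows₂ * A₂ - A₁' * R.toRows₂) := fun A₁ A₁' A₂ S R => by
    ext (a | a) b <;>
      simp [Matrix.mul_apply, Fintype.sum_sum_type]
  constructor
  · intro M N
    obtain ⟨S, R, h1, h2⟩ := h.1 M.toRows₁ N.toRows₁
    obtain ⟨S', R', h1', h2'⟩ := h'.1 M.toRows₂ N.toRows₂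
    refine ⟨fromRows S S', fromRows R R', ?_, ?_⟩
    · rintro (a | a) b hab
      · rw [key]; exact h1 a b hab
      · rw [key]; exact h1' a b hab
    · rintro (a | a) b hab
      · rw [key]; exact h2 a b hab
      · rw [key]; exact h2' a b hab
  · intro S R h1 h2
    rw [key] at h1 h2 ⊢
    rw [key]
    obtain ⟨h3, h4⟩ := h.2 S.toRows₁ R.toRows₁ (fun a b => h1 (.inl a) b)
      (fun a b => h2 (.inl a) b)
    obtain ⟨h3', h4'⟩ := h'.2 S.toRows₂ R.toRows₂ (fun a b => h1 (.inr a) b)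
      (fun a b => h2 (.inr a) b)
    rw [h3, h4, h3', h4', Matrix.fromRows_zero]
    exact ⟨rfl, rfl⟩

theorem IsComplementary.dirSum_right {A₂' B₂' : Matrix m₂' n₂' 𝕜} {P Q : m₁ → n₂ ⊕ n₂' → Prop}
    (h : IsComplementary A₁ B₁ A₂ B₂ (fun a b => P a (.inl b)) (fun a b => Q a (.inl b)))
    (h' : IsComplementary A₁ B₁ A₂' B₂' (fun a b => P a (.inr b)) (fun a b => Q a (.inr b))) :
    IsComplementary A₁ B₁ (dirSum A₂ A₂') (dirSum B₂ B₂') P Q := by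
  have := (h.transpose.dirSum_left (P := fun b a => P a b) (Q := fun b a => Q a b)
    h'.transpose).transpose
  simpa [Matrix.fromBlocks_transpose] using this

theorem IsComplementary.blockDiagonal'_left {o : Type} [Fintype o] [DecidableEq o]
    {m n : o → Type} [∀ i, Fintype (n i)]
    {A B : ∀ i, Matrix (m i) (n i) 𝕜} {P Q : (Σ i, m i) → n₂ → Prop}
    (h : ∀ i, IsComplementary (A i) (B i) A₂ B₂ (fun a => P ⟨i, a⟩) (fun a => Q ⟨i, a⟩)) :
    IsComplementary (blockDiagonal' A) (blockDiagonal' B) A₂ B₂ P Q := by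
  have key : ∀ (A : ∀ i, Matrix (m i) (n i) 𝕜) (A₂ : Matrix m₂ n₂ 𝕜)
      (S : Matrix (Σ i, m i) m₂ 𝕜) (R : Matrix (Σ i, n i) n₂ 𝕜) (i : o) (a : m i) (b : n₂),
      (S * A₂ - blockDiagonal' A * R) ⟨i, a⟩ b =
        (S.submatrix (Sigma.mk i) id * A₂ - A i * R.submatrix (Sigma.mk i) id) a b :=
    fun A A₂ S R i a b => by
    simp only [Matrix.sub_apply, Matrix.mul_apply, Fintype.sum_sigma, Matrix.submatrix_apply, id]
    congr 1
    rw [Finset.sum_eq_single i (fun j _ hj => Finset.sum_eq_zero fun k _ => by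
      rw [blockDiagonal'_apply_ne _ _ _ hj.symm, zero_mul]) (by simp)]
    simp
  constructor
  · intro M N
    choose S R h1 h2 using fun i => (h i).1 (M.submatrix (Sigma.mk i) id)
      (N.submatrix (Sigma.mk i) id)
    refine ⟨Matrix.of fun x => S x.1 x.2, Matrix.of fun x => R x.1 x.2, ?_, ?_⟩
    · rintro ⟨i, a⟩ b hab
      rw [key]; exact h1 i a b hab
    · rintro ⟨i, a⟩ b hab
      rw [key]; exact h2 i a b hab
  · intro S R h1 h2
    have h3 := fun i => (h i).2 _ _ (fun a b hab => (key A A₂ S R i a b).symm.trans (h1 _ b hab))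
      (fun a b hab => (key B B₂ S R i a b).symm.trans (h2 _ b hab))
    constructor
    · ext ⟨i, a⟩ b
      rw [key, (h3 i).1]; rfl
    · ext ⟨i, a⟩ b
      rw [key, (h3 i).2]; rfl

theorem IsComplementary.blockDiagonal'_right {o : Type} [Fintype o] [DecidableEq o]
    {m n : o → Type} [∀ i, Fintype (m i)]
    {A B : ∀ i, Matrix (m i) (n i) 𝕜} {P Q : m₁ → (Σ i, n i) → Prop}
    (h : ∀ i, IsComplementary A₁ B₁ (A i) (B i) (fun a b => P a ⟨i, b⟩) (fun a b => Q a ⟨i, b⟩)) :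
    IsComplementary A₁ B₁ (blockDiagonal' A) (blockDiagonal' B) P Q := by
  have := (IsComplementary.blockDiagonal'_left (P := fun b a => P a b) (Q := fun b a => Q a b)
    fun i => (h i).transpose).transpose
  simpa [Matrix.blockDiagonal'_transpose] using this

/-- Without stars in the first matrix, the first equation determines `R` from `S`, and only an
equation for `S` remains. -/
theorem IsComplementary.of_one [Fintype m₁] [DecidableEq m₁] {C : Matrix m₁ m₁ 𝕜}
    (h1 : ∀ N : Matrix m₁ n₂ 𝕜, ∃ S : Matrix m₁ m₂ 𝕜,
      ∀ a b, ¬ Q a b → (S * B₂ - C * (S * A₂)) a b = N a b)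
    (h2 : ∀ S : Matrix m₁ m₂ 𝕜, (∀ a b, ¬ Q a b → (S * B₂ - C * (S * A₂)) a b = 0) →
      S * B₂ - C * (S * A₂) = 0) :
    IsComplementary 1 C A₂ B₂ (fun _ _ => False) Q := by
  constructor
  · intro M N
    -- Substituting `R = S A₂ - M` into the second equation adds `C M` to its left side.
    obtain ⟨S, hS⟩ := h1 (N - C * M)
    refine ⟨S, S * A₂ - M, by simp, fun a b hab => ?_⟩
    have := hS a b hab
    rw [Matrix.mul_sub]
    simp only [Matrix.sub_apply] at this ⊢
    linear_combination this
  · intro S R hS hR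
    have h0 : S * A₂ - (1 : Matrix m₁ m₁ 𝕜) * R = 0 := by ext a b; exact hS a b id
    have : R = S * A₂ := by rw [Matrix.one_mul, sub_eq_zero] at h0; exact h0.symm
    subst this
    exact ⟨h0, h2 S hR⟩

theorem isComplementary_one_iff [Fintype m₁] [DecidableEq m₁] [DecidableEq m₂] {C : Matrix m₁ m₁ 𝕜}
    {C' : Matrix m₂ m₂ 𝕜} {Q : m₁ → m₂ → Prop} :
    IsComplementary 1 C 1 C' (fun _ _ => False) Q ↔
      (∀ N : Matrix m₁ m₂ 𝕜, ∃ S : Matrix m₁ m₂ 𝕜,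
        ∀ a b, ¬ Q a b → (S * C' - C * S) a b = N a b) ∧
      ∀ S : Matrix m₁ m₂ 𝕜, (∀ a b, ¬ Q a b → (S * C' - C * S) a b = 0) → S * C' - C * S = 0 := by
  constructor
  · intro h
    refine ⟨fun N => ?_, fun S hS => (h.2 S S (by simp) hS).2⟩
    obtain ⟨S, R, h1, h2⟩ := h.1 0 N
    have h0 : S * (1 : Matrix m₂ m₂ 𝕜) - (1 : Matrix m₁ m₁ 𝕜) * R = 0 := by ext a b; exact h1 a b id
    have : R = S := by rw [Matrix.one_mul, Matrix.mul_one, sub_eq_zero] at h0; exact h0.symm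
    subst this
    exact ⟨R, h2⟩
  · rintro ⟨h1, h2⟩
    exact .of_one (by simpa using h1) (by simpa using h2)

end Complementary

/-! ### Multiplication by `F` and `K` -/

section Entries

variable {𝕜 : Type} [RCLike 𝕜] {α β : Type} {r : ℕ}

theorem mul_F_apply (S : Matrix α (Fin r) 𝕜) (a : α) (b : Fin (r - 1)) :
    (S * F 𝕜 r) a b = S a ⟨b, by omega⟩ := by
  rw [Matrix.mul_apply, Finset.sum_eq_single ⟨b, by omega⟩] <;> simp +contextual [F, Fin.ext_iff]

theorem mul_K_apply (S : Matrix α (Fin r) 𝕜) (a : α) (b : Fin (r - 1)) :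
    (S * K 𝕜 r) a b = S a ⟨b + 1, by omega⟩ := by
  rw [Matrix.mul_apply, Finset.sum_eq_single ⟨b + 1, by omega⟩] <;>
    simp +contextual [K, Fin.ext_iff]

theorem F_mul_apply (R : Matrix (Fin (r - 1)) β 𝕜) (a : Fin r) (b : β) :
    (F 𝕜 r * R) a b = if h : a.val < r - 1 then R ⟨a, h⟩ b else 0 := by
  rw [Matrix.mul_apply]
  split_ifs with h
  · rw [Finset.sum_eq_single ⟨a, h⟩] <;> simp +contextual [F, Fin.ext_iff, eq_comm]
  · exact Finset.sum_eq_zero fun k _ => by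
      rw [F, if_neg (by omega), zero_mul]

theorem K_mul_apply (R : Matrix (Fin (r - 1)) β 𝕜) (a : Fin r) (b : β) :
    (K 𝕜 r * R) a b = if h : 0 < a.val then R ⟨a - 1, by omega⟩ b else 0 := by
  rw [Matrix.mul_apply]
  split_ifs with h
  · rw [Finset.sum_eq_single ⟨a - 1, by omega⟩]
    · rw [K, if_pos (by simp; omega), one_mul]
    · intro k _ hk
      rw [K, if_neg (by simp [Fin.ext_iff] at hk; omega), zero_mul]
    · simp
  · exact Finset.sum_eq_zero fun k _ => by
      rw [K, if_neg (by omega), zero_mul]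

theorem mul_F_transpose_apply (S : Matrix α (Fin (r - 1)) 𝕜) (a : α) (b : Fin r) :
    (S * (F 𝕜 r)ᵀ) a b = if h : b.val < r - 1 then S a ⟨b, h⟩ else 0 := by
  have := F_mul_apply Sᵀ b a
  rwa [← Matrix.transpose_apply (F 𝕜 r * Sᵀ), Matrix.transpose_mul, Matrix.transpose_transpose]
    at this

theorem mul_K_transpose_apply (S : Matrix α (Fin (r - 1)) 𝕜) (a : α) (b : Fin r) :
    (S * (K 𝕜 r)ᵀ) a b = if h : 0 < b.val then S a ⟨b - 1, by omega⟩ else 0 := by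
  have := K_mul_apply Sᵀ b a
  rwa [← Matrix.transpose_apply (K 𝕜 r * Sᵀ), Matrix.transpose_mul, Matrix.transpose_transpose]
    at this

theorem F_transpose_mul_apply (R : Matrix (Fin r) β 𝕜) (a : Fin (r - 1)) (b : β) :
    ((F 𝕜 r)ᵀ * R) a b = R ⟨a, by omega⟩ b := by
  have := mul_F_apply Rᵀ b a
  rwa [← Matrix.transpose_apply (Rᵀ * F 𝕜 r), Matrix.transpose_mul, Matrix.transpose_transpose]
    at this

theorem K_transpose_mul_apply (R : Matrix (Fin r) β 𝕜) (a : Fin (r - 1)) (b : β) :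
    ((K 𝕜 r)ᵀ * R) a b = R ⟨a + 1, by omega⟩ b := by
  have := mul_K_apply Rᵀ b a
  rwa [← Matrix.transpose_apply (Rᵀ * K 𝕜 r), Matrix.transpose_mul, Matrix.transpose_transpose]
    at this

/-- Reversing the order of rows and columns exchanges `F` and `K`, so some of the block computations
follow from others by symmetry. -/
theorem K_submatrix_rev : (K 𝕜 r).submatrix Fin.revPerm Fin.revPerm = F 𝕜 r := by
  ext a b
  simp only [Matrix.submatrix_apply, K, F, Fin.revPerm_apply, Fin.val_rev]
  congr 1
  simp only [eq_iff_iff]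
  omega

theorem F_submatrix_rev : (F 𝕜 r).submatrix Fin.revPerm Fin.revPerm = K 𝕜 r := by
  ext a b
  simp only [Matrix.submatrix_apply, K, F, Fin.revPerm_apply, Fin.val_rev]
  congr 1
  simp only [eq_iff_iff]
  omega

/-- The extension of a finite sequence by zero. -/
def zeroExt {γ : Type} [Zero γ] (f : Fin r → γ) (i : ℕ) : γ := if h : i < r then f ⟨i, h⟩ else 0

theorem zeroExt_of_lt {γ : Type} [Zero γ] (f : Fin r → γ) {i : ℕ} (h : i < r) :
    zeroExt f i = f ⟨i, h⟩ := dif_pos h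

/-- The extension of a matrix by zero entries. -/
def matrixExt {r s : ℕ} (M : Matrix (Fin r) (Fin s) 𝕜) (i j : ℕ) : 𝕜 :=
  if h : i < r ∧ j < s then M ⟨i, h.1⟩ ⟨j, h.2⟩ else 0

theorem matrixExt_of_lt {r s : ℕ} (M : Matrix (Fin r) (Fin s) 𝕜) {i j : ℕ} (hi : i < r)
    (hj : j < s) : matrixExt M i j = M ⟨i, hi⟩ ⟨j, hj⟩ := dif_pos ⟨hi, hj⟩

theorem matrixExt_fin {r s : ℕ} (M : Matrix (Fin r) (Fin s) 𝕜) (i : Fin r) (j : Fin s) :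
    matrixExt M i j = M i j := dif_pos ⟨i.2, j.2⟩

theorem matrixExt_of_le_left {r s : ℕ} (M : Matrix (Fin r) (Fin s) 𝕜) {i : ℕ} (j : ℕ)
    (hi : r ≤ i) : matrixExt M i j = 0 := dif_neg (by omega)

end Entries

/-! ### The systems for the individual blocks -/

section Cases

variable {𝕜 : Type} [RCLike 𝕜] {I J : Type} [Fintype I] [DecidableEq I] [Fintype J]
  [DecidableEq J]

/-- The solution of the recurrence `u 0 = 0`, `u (b + 1) = f b + C *ᵥ u b`. -/
def columnRec (C : Matrix I I 𝕜) (f : ℕ → I → 𝕜) : ℕ → I → 𝕜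
  | 0 => 0
  | b + 1 => f b + C *ᵥ columnRec C f b

/-- For the columns `u b` of `S` the equation is `u (b + 1) - C u b = N b`, a recurrence solvable
from any initial column. -/
theorem isComplementary_one_F_K (C : Matrix I I 𝕜) (r : ℕ) :
    IsComplementary 1 C (F 𝕜 r) (K 𝕜 r) (fun _ _ => False) (fun _ _ => False) := by
  refine .of_one (fun N => ?_) (fun S h => by ext a b; exact h a b id)
  set u := columnRec C fun b => zeroExt (fun b a => N a b) b with hu
  refine ⟨Matrix.of fun a b => u b a, fun a b _ => ?_⟩
  have : (C * ((Matrix.of fun a (b : Fin r) => u b a) * F 𝕜 r)) a b = (C *ᵥ u b) a := by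
    simp only [Matrix.mul_apply (M := C), mul_F_apply]
    rfl
  rw [Matrix.sub_apply, mul_K_apply, this]
  simp only [Matrix.of_apply, hu, columnRec, Pi.add_apply, zeroExt_of_lt _ b.2]
  ring

theorem isComplementary_one_K_F (C : Matrix I I 𝕜) (r : ℕ) :
    IsComplementary 1 C (K 𝕜 r) (F 𝕜 r) (fun _ _ => False) (fun _ _ => False) := by
  have := (isComplementary_one_F_K C r).reindex Fin.revPerm Fin.revPerm
  rwa [K_submatrix_rev, F_submatrix_rev] at this

/-- Each column of the equation except the last determines one new column of `S`; the last one
contains no new unknown and must be starred. -/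
theorem isComplementary_one_K_F_transpose (C : Matrix I I 𝕜) (r : ℕ) :
    IsComplementary 1 C (K 𝕜 r)ᵀ (F 𝕜 r)ᵀ (fun _ _ => False) starRight := by
  have key : ∀ (S : Matrix I (Fin (r - 1)) 𝕜) (a : I) (b : Fin r),
      (C * (S * (K 𝕜 r)ᵀ)) a b =
        (C *ᵥ fun i => if h : 0 < b.val then S i ⟨b - 1, by omega⟩ else 0) a := fun S a b => by
    simp only [Matrix.mul_apply (M := C), mul_K_transpose_apply]
    rfl
  refine .of_one (fun N => ?_) (fun S h => ?_)
  · set u := columnRec C fun b => zeroExt (fun b a => N a b) b with hu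
    -- The index is shifted so that `u 0 = 0` stands for the zero first column of `S Kᵀ`.
    refine ⟨Matrix.of fun a b => u (b + 1) a, fun a b hab => ?_⟩
    have hb : b.val < r - 1 := by
      have := b.2
      unfold starRight at hab
      omega
    have h0 : (fun i => if h : 0 < b.val then
        (Matrix.of fun a (b : Fin (r - 1)) => u (b + 1) a) i ⟨b - 1, by omega⟩ else 0) = u b := by
      ext i
      rcases b with ⟨_ | b, _⟩
      · simp [hu, columnRec]
      · simp
    rw [Matrix.sub_apply, key, h0, mul_F_transpose_apply, dif_pos hb]
    simp only [Matrix.of_apply, hu, columnRec, Pi.add_apply, zeroExt_of_lt _ b.2]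
    ring
  · have h0 : ∀ (k : ℕ) (hk : k < r - 1) (a : I), S a ⟨k, hk⟩ = 0 := by
      intro k
      induction k with
      | zero =>
        intro hk a
        have := h a ⟨0, by omega⟩ (by unfold starRight; simp; omega)
        rw [Matrix.sub_apply, key, mul_F_transpose_apply, dif_pos (by simpa using hk)] at this
        simpa [Matrix.mulVec, dotProduct] using this
      | succ k ih =>
        intro hk a
        have := h a ⟨k + 1, by omega⟩ (by unfold starRight; simp; omega)
        rw [Matrix.sub_apply, key, mul_F_transpose_apply, dif_pos (by simpa using hk)] at this
        simpa [Matrix.mulVec, dotProduct, ih (by omega)] using this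
    have : S = 0 := by
      ext a b
      exact h0 b b.2 a
    simp [this]

theorem isComplementary_one_F_K_transpose (C : Matrix I I 𝕜) (r : ℕ) :
    IsComplementary 1 C (F 𝕜 r)ᵀ (K 𝕜 r)ᵀ (fun _ _ => False) starLeft := by
  have := (isComplementary_one_K_F_transpose C r).reindex Fin.revPerm Fin.revPerm
  rw [← Matrix.transpose_submatrix, ← Matrix.transpose_submatrix, K_submatrix_rev,
    F_submatrix_rev] at this
  refine this.congr (fun _ _ => Iff.rfl) fun a b => ?_
  simp only [starLeft, starRight, Fin.revPerm_apply, Fin.val_rev]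
  have := b.2
  omega

/-- The equation `S - C S D = N` is solved by the Neumann series `∑ C ^ i N D ^ i`, which is finite
because `D` is nilpotent. -/
theorem isComplementary_one_nilpotent (C : Matrix I I 𝕜) {D : Matrix J J 𝕜} {k : ℕ}
    (hD : D ^ k = 0) :
    IsComplementary 1 C D 1 (fun _ _ => False) (fun _ _ => False) := by
  refine .of_one (fun N => ?_) (fun S h => by ext a b; exact h a b id)
  refine ⟨∑ i ∈ Finset.range k, C ^ i * N * D ^ i, fun a b _ => ?_⟩
  have key : ∀ k, (∑ i ∈ Finset.range k, C ^ i * N * D ^ i)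
      - C * ((∑ i ∈ Finset.range k, C ^ i * N * D ^ i) * D) = N - C ^ k * N * D ^ k := by
    intro k
    induction k with
    | zero => simp
    | succ k ih =>
      rw [Finset.sum_range_succ, Matrix.add_mul, Matrix.mul_add, add_sub_add_comm, ih, pow_succ',
        pow_succ]
      simp only [Matrix.mul_assoc]
      abel
  rw [Matrix.mul_one, key, hD, Matrix.mul_zero, sub_zero]

/-- The matrix with entries prescribed in column `0` and determined along the antidiagonals. -/
def antidiagRec (f : ℕ → 𝕜) (c : ℕ → ℕ → 𝕜) : ℕ → ℕ → 𝕜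
  | a, 0 => f a
  | a, b + 1 => antidiagRec f c (a + 1) b + c a b

/-- Eliminating `R` leaves `S (a, b + 1) = S (a + 1, b) + c (a, b)`; the recursion along
antidiagonals never meets a second boundary condition. -/
theorem isComplementary_F_K_transpose_F_K (q p : ℕ) :
    IsComplementary (F 𝕜 q)ᵀ (K 𝕜 q)ᵀ (F 𝕜 p) (K 𝕜 p) (fun _ _ => False)
      (fun _ _ => False) := by
  refine ⟨fun M N => ?_, fun S R hM hN => ⟨by ext a b; exact hM a b id,
    by ext a b; exact hN a b id⟩⟩
  set s := antidiagRec (fun _ => (0 : 𝕜)) (fun a b => matrixExt N a b - matrixExt M (a + 1) b)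
    with hs
  refine ⟨Matrix.of fun a b => s a b, Matrix.of fun a b => s a b - matrixExt M a b,
    fun a b _ => ?_, fun a b _ => ?_⟩
  · rw [Matrix.sub_apply, mul_F_apply, F_transpose_mul_apply]
    simp [matrixExt_fin]
  · rw [Matrix.sub_apply, mul_K_apply, K_transpose_mul_apply]
    simp [hs, antidiagRec, matrixExt_fin]

/-- There are as many unstarred equations as unknowns, and they are triangular along the
antidiagonals, so `S` and `R` are uniquely determined. -/
theorem isComplementary_F_K_F_K_transpose (p q : ℕ) (hp : 1 ≤ p) (hq : 1 ≤ q) :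
    IsComplementary (F 𝕜 p) (K 𝕜 p) (F 𝕜 q)ᵀ (K 𝕜 q)ᵀ starRight starUp := by
  constructor
  · intro M N
    set s := antidiagRec (fun a => matrixExt M a 0 - matrixExt N (a + 1) 0)
      (fun a b => matrixExt M a (b + 1) - matrixExt N (a + 1) (b + 1)) with hs
    set t : ℕ → ℕ → 𝕜 := fun a b => (if 0 < b then s (a + 1) (b - 1) else 0)
      - matrixExt N (a + 1) b with ht
    have hst : ∀ a b, s a b = matrixExt M a b + t a b := by
      rintro a (_ | b)
      · simp [hs, ht, antidiagRec, sub_eq_add_neg]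
      · simp only [hs, ht, antidiagRec, Nat.succ_pos, if_true, Nat.add_sub_cancel]
        ring
    -- The arrays continue below the matrices, and vanishing there forces row `p - 1` of `t` to
    -- vanish; that row represents the zero last row of `F R`.
    have hs0 : ∀ b a, p ≤ a → s a b = 0 := by
      intro b
      induction b with
      | zero =>
        intro a ha
        simp [hs, antidiagRec, matrixExt_of_le_left _ _ ha,
          matrixExt_of_le_left _ _ (show p ≤ a + 1 by omega)]
      | succ b ih =>
        intro a ha
        rw [hst]
        simp [ht, ih (a + 1) (by omega), matrixExt_of_le_left _ _ ha,
          matrixExt_of_le_left _ _ (show p ≤ a + 1 by omega)]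
    have ht0 : ∀ a b, p ≤ a + 1 → t a b = 0 := fun a b ha => by
      simp [ht, hs0 _ _ ha, matrixExt_of_le_left _ _ ha]
    refine ⟨Matrix.of fun a b => s a b, Matrix.of fun a b => t a b, fun a b hab => ?_,
      fun a b hab => ?_⟩
    · have hb : b.val < q - 1 := by
        have := b.2
        unfold starRight at hab
        omega
      rw [Matrix.sub_apply, mul_F_transpose_apply, dif_pos hb, F_mul_apply]
      simp only [Matrix.of_apply, hst, matrixExt_fin]
      split_ifs with ha
      · ring
      · rw [ht0 _ _ (by omega)]
        ring
    · have ha : 0 < a.val := Nat.pos_of_ne_zero hab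
      rw [Matrix.sub_apply, mul_K_transpose_apply, K_mul_apply, dif_pos ha]
      simp only [Matrix.of_apply, ht, Nat.sub_add_cancel ha, matrixExt_fin]
      split_ifs <;> ring
  · intro S R hM hN
    have h1 : ∀ a b (ha : a < p - 1) (hb : b < q), R ⟨a, ha⟩ ⟨b, hb⟩ =
        if h : 0 < b then S ⟨a + 1, by omega⟩ ⟨b - 1, by omega⟩ else 0 := by
      intro a b ha hb
      have := hN ⟨a + 1, by omega⟩ ⟨b, hb⟩ (by simp [starUp])
      rw [Matrix.sub_apply, mul_K_transpose_apply, K_mul_apply,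
        dif_pos (show 0 < (⟨a + 1, by omega⟩ : Fin p).val from Nat.succ_pos a)] at this
      exact (sub_eq_zero.1 this).symm
    have h2 : ∀ a b (ha : a < p) (hb : b < q - 1), S ⟨a, ha⟩ ⟨b, hb⟩ =
        if h : a < p - 1 then R ⟨a, h⟩ ⟨b, by omega⟩ else 0 := by
      intro a b ha hb
      have := hM ⟨a, ha⟩ ⟨b, by omega⟩ (by simp only [starRight]; omega)
      rw [Matrix.sub_apply, mul_F_transpose_apply, F_mul_apply, dif_pos (by simpa using hb)] at this
      exact sub_eq_zero.1 this
    have h3 : ∀ b a (ha : a < p) (hb : b < q - 1), S ⟨a, ha⟩ ⟨b, hb⟩ = 0 := by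
      intro b
      induction b with
      | zero =>
        intro a ha hb
        rw [h2]
        split_ifs with h
        · rw [h1, dif_neg (by simp)]
        · rfl
      | succ b ih =>
        intro a ha hb
        rw [h2]
        split_ifs with h
        · rw [h1, dif_pos (by simp)]
          exact ih _ _ _
        · rfl
    have hS : S = 0 := by
      ext a b
      exact h3 b a a.2 b.2
    have hR : R = 0 := by
      ext a b
      rw [← Fin.eta a a.2, ← Fin.eta b b.2, h1]
      simp [hS]
    simp [hS, hR]

/-- The array with prescribed first row, zero first column below it, and differences `c` along
the diagonals. -/
def diagRec (f : ℕ → 𝕜) (c : ℕ → ℕ → 𝕜) : ℕ → ℕ → 𝕜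
  | 0, 0 => 0
  | 0, b + 1 => f b
  | _ + 1, 0 => 0
  | a + 1, b + 1 => diagRec f c a b + c a b

/-- An array with row `0` prescribed and differences `-c` along the antidiagonals; its row `k` is
the `k`-th row from below of a matrix with `p` rows and differences `c` along the diagonals. -/
def codiagRec {G : Type} [AddCommGroup G] (p : ℕ) (f : ℕ → G) (c : ℕ → ℕ → G) : ℕ → ℕ → G
  | 0, b => f b
  | k + 1, b => codiagRec p f c k (b + 1) - c (p - 2 - k) b

/-- Eliminating `R` prescribes the differences of `S` along diagonals. The first equation also
prescribes the last row of `S` except its last entry, and the second prescribes the first row except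
its first entry. Diagonals that meet both prescribed parts are overdetermined, and `Z` stars exactly
their conditions in the first row. -/
theorem isComplementary_F_K_F_K (p q : ℕ) (hp : 1 ≤ p) :
    IsComplementary (F 𝕜 p) (K 𝕜 p) (F 𝕜 q) (K 𝕜 q) (fun _ _ => False) starZ := by
  constructor
  · intro M N
    set c : ℕ → ℕ → 𝕜 := fun a b => matrixExt N (a + 1) b - matrixExt M a b with hc
    set f := diagRec (fun b => matrixExt N 0 b) c with hf
    set g := codiagRec p (fun b => matrixExt M (p - 1) b) c with hg
    -- The condition says that the diagonal through `(a, b)` meets row `p - 1` left of column `q -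
    -- 1`. Such a diagonal is filled from below, every other one from above.
    set s : ℕ → ℕ → 𝕜 := fun a b => if p + b < q + a then g (p - 1 - a) b else f a b with hs
    have hrec : ∀ a b, a < p - 1 → s (a + 1) (b + 1) = s a b + c a b := by
      intro a b ha
      have h1 : p + (b + 1) < q + (a + 1) ↔ p + b < q + a := by omega
      simp only [hs, h1]
      split_ifs
      · rw [show p - 1 - a = (p - 1 - (a + 1)) + 1 by omega]
        simp only [hg, codiagRec]
        rw [show p - 2 - (p - 1 - (a + 1)) = a by omega]
        ring
      · simp [hf, diagRec]
    refine ⟨Matrix.of fun a b => s a b, Matrix.of fun a b => s a b - matrixExt M a b,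
      fun a b hab => ?_, fun a b hab => ?_⟩
    · rw [Matrix.sub_apply, mul_F_apply, F_mul_apply]
      split_ifs with ha
      · simp [matrixExt_fin]
      · have h1 : a.val = p - 1 := by omega
        have h2 : p + b.val < q + (p - 1) := by omega
        simp only [Matrix.of_apply, hs, h1, h2, if_true, hg, Nat.sub_self, codiagRec]
        rw [← h1, matrixExt_fin, sub_zero]
    · rw [Matrix.sub_apply, mul_K_apply, K_mul_apply]
      rcases a with ⟨_ | a, ha⟩
      · have h2 : ¬ p + (b.val + 1) < q + 0 := by
          simp only [starZ, true_and] at hab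
          omega
        simp only [Matrix.of_apply, hs, h2, if_false, hf, diagRec]
        simp [matrixExt_of_lt _ ha b.2]
      · simp only [Matrix.of_apply, hrec a b (by omega), hc, matrixExt_of_lt _ ha b.2]
        simp
  · intro S R hM hN
    have h1 : ∀ a b (ha : a < p) (hb : b < q - 1), S ⟨a, ha⟩ ⟨b, by omega⟩ =
        if h : a < p - 1 then R ⟨a, h⟩ ⟨b, hb⟩ else 0 := by
      intro a b ha hb
      have := hM ⟨a, ha⟩ ⟨b, hb⟩ id
      rw [Matrix.sub_apply, mul_F_apply, F_mul_apply] at this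
      exact sub_eq_zero.1 this
    have h2 : ∀ a b (ha : a < p - 1) (hb : b < q - 1), S ⟨a + 1, by omega⟩ ⟨b + 1, by omega⟩ =
        R ⟨a, ha⟩ ⟨b, hb⟩ := by
      intro a b ha hb
      have := hN ⟨a + 1, by omega⟩ ⟨b, hb⟩ (by simp [starZ])
      rw [Matrix.sub_apply, mul_K_apply, K_mul_apply, dif_pos (by simp)] at this
      exact sub_eq_zero.1 this
    -- On a diagonal that ends in the prescribed part of the last row, zero propagates upwards and
    -- reaches the starred entries.
    have h3 : ∀ k a b (ha : a < p) (hb : b < q - 1), a + k = p - 1 → b + k < q - 1 →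
        S ⟨a, ha⟩ ⟨b, by omega⟩ = 0 := by
      intro k
      induction k with
      | zero =>
        intro a b ha hb hk _
        rw [h1 a b ha hb, dif_neg (by omega)]
      | succ k ih =>
        intro a b ha hb hk hk'
        rw [h1 a b ha hb, dif_pos (by omega), ← h2 a b (by omega) hb]
        exact ih (a + 1) (b + 1) (by omega) (by omega) (by omega) (by omega)
    refine ⟨by ext a b; exact hM a b id, ?_⟩
    ext a b
    by_cases hab : starZ a b
    · obtain ⟨ha, hb⟩ := hab
      rw [Matrix.sub_apply, mul_K_apply, K_mul_apply, dif_neg (by omega), sub_zero,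
        ← Fin.eta a a.2]
      exact h3 (p - 1) a (b + 1) a.2 (by omega) (by omega) (by omega)
    · exact hN a b hab

end Cases

/-! ### Blocks obtained by transposition -/

section TransposedCases

variable {𝕜 : Type} [RCLike 𝕜] {I J : Type} [Fintype I] [DecidableEq I] [Fintype J]
  [DecidableEq J]

theorem isComplementary_F_K_one (C : Matrix I I 𝕜) (r : ℕ) :
    IsComplementary (F 𝕜 r) (K 𝕜 r) 1 C (fun _ _ => False) starUp := by
  simpa only [Matrix.transpose_one, Matrix.transpose_transpose] using
    (isComplementary_one_F_K_transpose Cᵀ r).transpose.congr (Q' := starUp)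
      (fun _ _ => Iff.rfl) (fun _ _ => Iff.rfl)

theorem isComplementary_F_K_right_one (D : Matrix I I 𝕜) (r : ℕ) :
    IsComplementary (F 𝕜 r) (K 𝕜 r) D 1 starDown (fun _ _ => False) := by
  simpa only [Matrix.transpose_one, Matrix.transpose_transpose] using
    (isComplementary_one_K_F_transpose Dᵀ r).swap.transpose.congr (P' := starDown)
      (fun _ _ => Iff.rfl) (fun _ _ => Iff.rfl)

theorem isComplementary_F_K_transpose_one (C : Matrix I I 𝕜) (r : ℕ) :
    IsComplementary (F 𝕜 r)ᵀ (K 𝕜 r)ᵀ 1 C (fun _ _ => False) (fun _ _ => False) := by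
  simpa only [Matrix.transpose_one, Matrix.transpose_transpose] using
    (isComplementary_one_F_K Cᵀ r).transpose

theorem isComplementary_F_K_transpose_right_one (D : Matrix I I 𝕜) (r : ℕ) :
    IsComplementary (F 𝕜 r)ᵀ (K 𝕜 r)ᵀ D 1 (fun _ _ => False) (fun _ _ => False) := by
  simpa only [Matrix.transpose_one, Matrix.transpose_transpose] using
    (isComplementary_one_K_F Dᵀ r).swap.transpose

theorem isComplementary_nilpotent_one (C : Matrix I I 𝕜) {D : Matrix J J 𝕜} {k : ℕ}
    (hD : D ^ k = 0) : IsComplementary D 1 1 C (fun _ _ => False) (fun _ _ => False) := by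
  simpa only [Matrix.transpose_one, Matrix.transpose_transpose] using
    (isComplementary_one_nilpotent Cᵀ (D := Dᵀ) (k := k)
      (by rw [← Matrix.transpose_pow, hD, Matrix.transpose_zero])).transpose

end TransposedCases

/-! ### Assembling the sixteen kinds of blocks -/

section Pencil

variable {𝕜 : Type} [RCLike 𝕜] {l r : ℕ} {p : Fin l → ℕ} {q : Fin r → ℕ} {I J : Type}

/-- The places in the block of `C` that satisfy `P`. -/
def inBlockC (p : Fin l → ℕ) (q : Fin r → ℕ) (J : Type) (P : I → I → Prop) :
    Rows p q I J → Cols p q I J → Prop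
  | .inr (.inl x), .inr (.inl y) => P x y
  | _, _ => False

/-- The places in the block of `D` that satisfy `P`. -/
def inBlockD (p : Fin l → ℕ) (q : Fin r → ℕ) (I : Type) (P : J → J → Prop) :
    Rows p q I J → Cols p q I J → Prop
  | .inr (.inr (.inl x)), .inr (.inr (.inl y)) => P x y
  | _, _ => False

variable [Fintype I] [DecidableEq I] [Fintype J] [DecidableEq J]

theorem isComplementary_pencil (hp : ∀ i, 1 ≤ p i) (hp_mono : Monotone p)
    (hq : ∀ j, 1 ≤ q j) (hq_anti : Antitone q) {C : Matrix I I 𝕜} {D : Matrix J J 𝕜} {k : ℕ}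
    (hD0 : D ^ k = 0) {P : I → I → Prop} {Q : J → J → Prop}
    (hC : IsComplementary 1 C 1 C (fun _ _ => False) P)
    (hD : IsComplementary 1 D 1 D (fun _ _ => False) Q) :
    IsComplementary (pencilA p q D) (pencilB p q C) (pencilA p q D) (pencilB p q C)
      (fun x y => starA p q I J x y ∨ inBlockD p q I Q x y)
      (fun x y => starB p q I J x y ∨ inBlockC p q J P x y) := by
  refine .dirSum_left ?_ (.dirSum_left ?_ (.dirSum_left ?_ ?_)) <;>
    refine .dirSum_right ?_ (.dirSum_right ?_ (.dirSum_right ?_ ?_))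
  · refine .blockDiagonal'_left fun i => .blockDiagonal'_right fun i' => ?_
    refine (isComplementary_F_K_F_K (p i) (p i') (hp i)).congr
      (fun a b => by simp [starA, inBlockD]) fun a b => ?_
    simp only [starB, inBlockC, or_false, and_iff_right_iff_imp]
    rintro ⟨_, h⟩
    -- For `i' ≤ i` monotonicity gives `p i' ≤ p i`, so `Z` has no stars; this is why only blocks
    -- above the diagonal carry parameters.
    by_contra hi
    have := hp_mono (not_lt.1 hi)
    omega
  · exact .blockDiagonal'_left fun i => (isComplementary_F_K_one C (p i)).congr
      (fun a b => by simp [starA, inBlockD]) fun a b => by simp [starB, inBlockC]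
  · exact .blockDiagonal'_left fun i => (isComplementary_F_K_right_one D (p i)).congr
      (fun a b => by simp [starA, inBlockD]) fun a b => by simp [starB, inBlockC]
  · exact .blockDiagonal'_left fun i => .blockDiagonal'_right fun j =>
      (isComplementary_F_K_F_K_transpose (p i) (q j) (hp i) (hq j)).congr
        (fun a b => by simp [starA, inBlockD, starRight])
        fun a b => by simp [starB, inBlockC, starUp]
  · exact .blockDiagonal'_right fun i => (isComplementary_one_F_K C (p i)).congr
      (fun a b => by simp [starA, inBlockD]) fun a b => by simp [starB, inBlockC]
  · exact hC.congr (fun a b => by simp [starA, inBlockD]) fun a b => by simp [starB, inBlockC]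
  · exact (isComplementary_one_nilpotent C hD0).congr
      (fun a b => by simp [starA, inBlockD]) fun a b => by simp [starB, inBlockC]
  · exact .blockDiagonal'_right fun j => (isComplementary_one_F_K_transpose C (q j)).congr
      (fun a b => by simp [starA, inBlockD]) fun a b => by simp [starB, inBlockC, starLeft]
  · exact .blockDiagonal'_right fun i => (isComplementary_one_K_F D (p i)).swap.congr
      (fun a b => by simp [starA, inBlockD]) fun a b => by simp [starB, inBlockC]
  · exact (isComplementary_nilpotent_one C hD0).congr
      (fun a b => by simp [starA, inBlockD]) fun a b => by simp [starB, inBlockC]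
  · exact hD.swap.congr (fun a b => by simp [starA, inBlockD]) fun a b => by simp [starB, inBlockC]
  · exact .blockDiagonal'_right fun j => (isComplementary_one_K_F_transpose D (q j)).swap.congr
      (fun a b => by simp [starA, inBlockD, starRight]) fun a b => by simp [starB, inBlockC]
  · exact .blockDiagonal'_left fun j => .blockDiagonal'_right fun i =>
      (isComplementary_F_K_transpose_F_K (q j) (p i)).congr
        (fun a b => by simp [starA, inBlockD]) fun a b => by simp [starB, inBlockC]
  · exact .blockDiagonal'_left fun j => (isComplementary_F_K_transpose_one C (q j)).congr
      (fun a b => by simp [starA, inBlockD]) fun a b => by simp [starB, inBlockC]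
  · exact .blockDiagonal'_left fun j => (isComplementary_F_K_transpose_right_one D (q j)).congr
      (fun a b => by simp [starA, inBlockD]) fun a b => by simp [starB, inBlockC]
  · refine .blockDiagonal'_left fun j => .blockDiagonal'_right fun j' => ?_
    refine (isComplementary_F_K_F_K (q j') (q j) (hq j')).transpose.congr
      (fun a b => by simp [starA, inBlockD]) fun a b => ?_
    simp only [starB, inBlockC, or_false, and_iff_right_iff_imp]
    rintro ⟨_, h⟩
    by_contra hj
    have := hq_anti (not_lt.1 hj)
    omega

end Pencil

/-! ### From quiver representations to matrices -/

section Transfer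

variable {𝕜 : Type} [RCLike 𝕜] {R K : Type}

instance [Fintype R] : Fintype (Entry fun _ : Quiver.SingleObj Unit => R) :=
  .ofInjective (β := R × R) (fun e => (e.row, e.col)) fun ⟨_, _, _, _, _⟩ ⟨_, _, _, _, _⟩ h => by
    cases h; rfl

instance : Fintype (Quiver.SingleObj Unit) := inferInstanceAs (Fintype Unit)

open Classical in
instance : Fintype KronVertex :=
  .ofSurjective (α := Bool) (fun b => if b then .source else .target) fun v => by
    cases v
    · exact ⟨true, rfl⟩
    · exact ⟨false, rfl⟩

theorem isTransversal_loopRep_iff [Fintype R] [DecidableEq R] {C : Matrix R R 𝕜}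
    {P : Set (Entry fun _ : Quiver.SingleObj Unit => R)} :
    IsTransversal (loopRep C) P ↔ IsComplementary 1 C 1 C (fun _ _ => False)
      (fun a b => (⟨.star _, .star _, (), a, b⟩ : Entry fun _ : Quiver.SingleObj Unit => R) ∈ P) := by
  rw [isComplementary_one_iff]
  constructor
  · rintro ⟨h1, h2⟩
    refine ⟨fun N => ?_, fun S hS => ?_⟩
    · obtain ⟨X, hX⟩ := h1 fun e => N e.row e.col
      exact ⟨Matrix.of (X (.star _)), fun a b hab => hX _ hab⟩
    · have := h2 (fun _ => S) fun e he => hS e.row e.col he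
      ext a b
      exact congrFun this ⟨.star _, .star _, (), a, b⟩
  · rintro ⟨h1, h2⟩
    refine ⟨fun y => ?_, fun X hX => ?_⟩
    · obtain ⟨S, hS⟩ := h1 (Matrix.of fun a b => y ⟨.star _, .star _, (), a, b⟩)
      exact ⟨fun _ => S, fun e he => hS e.row e.col he⟩
    · have := h2 (Matrix.of (X (.star _))) fun a b hab => hX _ hab
      ext e
      exact congrFun (congrFun this e.row) e.col

/-- An entry of the first matrix of a pair. -/
def entryFst (x : R × K) : Entry (pairDim R K) := ⟨.source, .target, .fst, x.1, x.2⟩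

/-- An entry of the second matrix of a pair. -/
def entrySnd (x : R × K) : Entry (pairDim R K) := ⟨.source, .target, .snd, x.1, x.2⟩

theorem entry_pairDim_cases {motive : Entry (pairDim R K) → Prop}
    (fst : ∀ x, motive (entryFst x)) (snd : ∀ x, motive (entrySnd x)) (e) : motive e := by
  obtain ⟨_, _, (_ | _), x, y⟩ := e
  · exact fst (x, y)
  · exact snd (x, y)

/-- Which entry of which matrix a position in a pair is. -/
def entrySplit : Entry (pairDim R K) → (R × K) ⊕ (R × K)
  | ⟨_, _, .fst, x, y⟩ => .inl (x, y)
  | ⟨_, _, .snd, x, y⟩ => .inr (x, y)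

theorem entryFst_injective : Function.Injective (entryFst (R := R) (K := K)) := fun _ _ h =>
  Sum.inl_injective (congrArg entrySplit h)

theorem entrySnd_injective : Function.Injective (entrySnd (R := R) (K := K)) := fun _ _ h =>
  Sum.inr_injective (congrArg entrySplit h)

theorem entryFst_ne_entrySnd (x y : R × K) : entryFst x ≠ entrySnd y := fun h =>
  Sum.inl_ne_inr (congrArg entrySplit h)

open Classical in
instance [Fintype R] [Fintype K] : Fintype (Entry (pairDim R K)) :=
  .ofSurjective (α := (R × K) ⊕ (R × K)) (Sum.elim entryFst entrySnd)
    (entry_pairDim_cases (fun x => ⟨.inl x, rfl⟩) fun x => ⟨.inr x, rfl⟩)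

theorem IsComplementary.isTransversal_pairRep [Fintype R] [Fintype K] {A B : Matrix R K 𝕜}
    {P : Set (Entry (pairDim R K))}
    (h : IsComplementary A B A B (fun a b => entryFst (a, b) ∈ P)
      (fun a b => entrySnd (a, b) ∈ P)) : IsTransversal (pairRep A B) P := by
  constructor
  · intro y
    obtain ⟨S, T, h1, h2⟩ := h.1 (Matrix.of fun a b => y (entryFst (a, b)))
      (Matrix.of fun a b => y (entrySnd (a, b)))
    refine ⟨fun v => match v with | .source => T | .target => S, ?_⟩
    refine entry_pairDim_cases (fun x hx => ?_) fun x hx => ?_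
    · exact h1 x.1 x.2 hx
    · exact h2 x.1 x.2 hx
  · intro X hX
    obtain ⟨h1, h2⟩ := h.2 (Matrix.of (X .target)) (Matrix.of (X .source))
      (fun a b hab => hX _ hab) (fun a b hab => hX _ hab)
    ext e
    revert e
    refine entry_pairDim_cases (fun x => ?_) fun x => ?_
    · exact congrFun (congrFun h1 x.1) x.2
    · exact congrFun (congrFun h2 x.1) x.2

end Transfer

/-! ### Positions of the parameters in the deformed pair -/

section PairDeformation

variable {𝕜 : Type} [RCLike 𝕜] {l r : ℕ} {p : Fin l → ℕ} {q : Fin r → ℕ} {I J : Type}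

theorem starMatrix_of {R K : Type} {S : R → K → Prop} (x : Stars S → 𝕜) {i : R} {j : K}
    (h : S i j) : starMatrix S x i j = x ⟨(i, j), h⟩ := dif_pos h

theorem starMatrix_of_not {R K : Type} {S : R → K → Prop} (x : Stars S → 𝕜) {i : R} {j : K}
    (h : ¬ S i j) : starMatrix S x i j = 0 := dif_neg h

theorem pencilA_apply_congr [DecidableEq I] {D D' : Matrix J J 𝕜} {x : Rows p q I J}
    {y : Cols p q I J}
    (h : ∀ a b, x = .inr (.inr (.inl a)) → y = .inr (.inr (.inl b)) → D' a b = D a b) :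
    pencilA p q D' x y = pencilA p q D x y := by
  rcases x with x | x | x | x <;> rcases y with y | y | y | y <;>
    first | rfl | exact h _ _ rfl rfl

theorem pencilB_apply_congr [DecidableEq J] {C C' : Matrix I I 𝕜} {x : Rows p q I J}
    {y : Cols p q I J}
    (h : ∀ a b, x = .inr (.inl a) → y = .inr (.inl b) → C' a b = C a b) :
    pencilB p q C' x y = pencilB p q C x y := by
  rcases x with x | x | x | x <;> rcases y with y | y | y | y <;>
    first | rfl | exact h _ _ rfl rfl

theorem pairRep_entryFst {R K 𝕜 : Type} (A B : Matrix R K 𝕜) (x : R × K) :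
    (pairRep A B).entry (entryFst x) = A x.1 x.2 := rfl

theorem pairRep_entrySnd {R K 𝕜 : Type} (A B : Matrix R K 𝕜) (x : R × K) :
    (pairRep A B).entry (entrySnd x) = B x.1 x.2 := rfl

variable {ιC ιD : Type}

/-- The places of the parameters in the deformed pair. -/
def pairPos (posC : ιC → Entry fun _ : Quiver.SingleObj Unit => I)
    (posD : ιD → Entry fun _ : Quiver.SingleObj Unit => J) :
    Params p q I J ιC ιD → Entry (pairDim (Rows p q I J) (Cols p q I J))
  | .inl (.inl k) => entrySnd (.inr (.inl (posC k).row), .inr (.inl (posC k).col))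
  | .inl (.inr k) => entryFst (.inr (.inr (.inl (posD k).row)), .inr (.inr (.inl (posD k).col)))
  | .inr (.inl k) => entryFst k.1
  | .inr (.inr k) => entrySnd k.1

variable {posC : ιC → Entry fun _ : Quiver.SingleObj Unit => I}
  {posD : ιD → Entry fun _ : Quiver.SingleObj Unit => J}

theorem entryFst_mem_range_pairPos_iff {x : Rows p q I J × Cols p q I J} :
    entryFst x ∈ Set.range (pairPos (p := p) (q := q) posC posD) ↔ starA p q I J x.1 x.2 ∨
      inBlockD p q I (fun a b => (⟨.star _, .star _, (), a, b⟩ :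
        Entry fun _ : Quiver.SingleObj Unit => J) ∈ Set.range posD) x.1 x.2 := by
  constructor
  · rintro ⟨(k | k) | (k | k), hk⟩
    · exact absurd hk.symm (entryFst_ne_entrySnd _ _)
    · rw [← entryFst_injective hk]
      exact .inr ⟨k, rfl⟩
    · rw [← entryFst_injective hk]
      exact .inl k.2
    · exact absurd hk.symm (entryFst_ne_entrySnd _ _)
  · rintro (h | h)
    · exact ⟨.inr (.inl ⟨x, h⟩), rfl⟩
    · obtain ⟨x | x | x | x, y | y | y | y⟩ := x <;> simp only [inBlockD] at h
      obtain ⟨k, hk⟩ := h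
      refine ⟨.inl (.inr k), ?_⟩
      simp only [pairPos, hk]

theorem entrySnd_mem_range_pairPos_iff {x : Rows p q I J × Cols p q I J} :
    entrySnd x ∈ Set.range (pairPos (p := p) (q := q) posC posD) ↔ starB p q I J x.1 x.2 ∨
      inBlockC p q J (fun a b => (⟨.star _, .star _, (), a, b⟩ :
        Entry fun _ : Quiver.SingleObj Unit => I) ∈ Set.range posC) x.1 x.2 := by
  constructor
  · rintro ⟨(k | k) | (k | k), hk⟩
    · rw [← entrySnd_injective hk]
      exact .inr ⟨k, rfl⟩
    · exact absurd hk (entryFst_ne_entrySnd _ _)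
    · exact absurd hk (entryFst_ne_entrySnd _ _)
    · rw [← entrySnd_injective hk]
      exact .inl k.2
  · rintro (h | h)
    · exact ⟨.inr (.inr ⟨x, h⟩), rfl⟩
    · obtain ⟨x | x | x | x, y | y | y | y⟩ := x <;> simp only [inBlockC] at h
      obtain ⟨k, hk⟩ := h
      refine ⟨.inl (.inl k), ?_⟩
      simp only [pairPos, hk]

theorem loop_entry_ext {R : Type} {e e' : Entry fun _ : Quiver.SingleObj Unit => R}
    (h1 : e.row = e'.row) (h2 : e.col = e'.col) : e = e' := by
  obtain ⟨_, _, _, _, _⟩ := e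
  obtain ⟨_, _, _, _, _⟩ := e'
  cases h1
  cases h2
  rfl

theorem pairPos_injective (hC : Function.Injective posC) (hD : Function.Injective posD) :
    Function.Injective (pairPos (p := p) (q := q) posC posD) := by
  rintro ((k | k) | (k | k)) ((k' | k') | (k' | k')) h
  · have := entrySnd_injective h
    simp only [Prod.mk.injEq, Sum.inr.injEq, Sum.inl.injEq] at this
    rw [hC (loop_entry_ext this.1 this.2)]
  · exact absurd h.symm (entryFst_ne_entrySnd _ _)
  · exact absurd h.symm (entryFst_ne_entrySnd _ _)
  -- On the block of `C` the predicate `starB` is `False`, so the parameters of `C'` never collide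
  -- with the stars.
  · have h1 := k'.2
    rw [← entrySnd_injective h] at h1
    exact h1.elim
  · exact absurd h (entryFst_ne_entrySnd _ _)
  · have := entryFst_injective h
    simp only [Prod.mk.injEq, Sum.inr.injEq, Sum.inl.injEq] at this
    rw [hD (loop_entry_ext this.1 this.2)]
  · have h1 := k'.2
    rw [← entryFst_injective h] at h1
    exact h1.elim
  · exact absurd h (entryFst_ne_entrySnd _ _)
  · exact absurd h (entryFst_ne_entrySnd _ _)
  · have h1 := k.2
    rw [entryFst_injective h] at h1
    exact h1.elim
  · rw [Subtype.ext (entryFst_injective h)]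
  · exact absurd h (entryFst_ne_entrySnd _ _)
  · have h1 := k.2
    rw [entrySnd_injective h] at h1
    exact h1.elim
  · exact absurd h.symm (entryFst_ne_entrySnd _ _)
  · exact absurd h.symm (entryFst_ne_entrySnd _ _)
  · rw [Subtype.ext (entrySnd_injective h)]

theorem isSimplestMiniversal_pair [Fintype I] [DecidableEq I] [Fintype J] [DecidableEq J]
    [Fintype ιC] [Fintype ιD] (hp : ∀ i, 1 ≤ p i) (hp_mono : Monotone p)
    (hq : ∀ j, 1 ≤ q j) (hq_anti : Antitone q) {C : Matrix I I 𝕜} {D : Matrix J J 𝕜} {k : ℕ}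
    (hD0 : D ^ k = 0) {C' : (ιC → 𝕜) → Matrix I I 𝕜} {D' : (ιD → 𝕜) → Matrix J J 𝕜}
    (hC : IsSimplestMiniversal (loopRep C) fun t => loopRep (C' t))
    (hD : IsSimplestMiniversal (loopRep D) fun t => loopRep (D' t)) :
    IsSimplestMiniversal (pairRep (pencilA p q D) (pencilB p q C))
      fun t : Params p q I J ιC ιD → 𝕜 => pairRep (deformA p q D' t) (deformB p q C' t) := by
  obtain ⟨posC, hposC, hC', hCt⟩ := isSimplestMiniversal_iff.1 hC
  obtain ⟨posD, hposD, hD', hDt⟩ := isSimplestMiniversal_iff.1 hD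
  refine isSimplestMiniversal_iff.2 ⟨pairPos posC posD, pairPos_injective hposC hposD, fun t => ?_,
    ?_⟩
  · constructor
    · rintro ((k | k) | (k | k))
      · have h1 := (hC' fun k => t (.inl (.inl k))).1 k
        simp only [pairPos, pairRep_entrySnd, deformB, Matrix.add_apply]
        rw [starMatrix_of_not _ (by exact id), add_zero]
        exact h1
      · have h1 := (hD' fun k => t (.inl (.inr k))).1 k
        simp only [pairPos, pairRep_entryFst, deformA, Matrix.add_apply]
        rw [starMatrix_of_not _ (by exact id), add_zero]
        exact h1
      · simp only [pairPos, pairRep_entryFst, deformA, Matrix.add_apply]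
        rw [starMatrix_of _ k.2]
        congr 1
        refine pencilA_apply_congr fun a b ha hb => ?_
        have h1 := k.2
        rw [ha, hb] at h1
        exact h1.elim
      · simp only [pairPos, pairRep_entrySnd, deformB, Matrix.add_apply]
        rw [starMatrix_of _ k.2]
        congr 1
        refine pencilB_apply_congr fun a b ha hb => ?_
        have h1 := k.2
        rw [ha, hb] at h1
        exact h1.elim
    · refine entry_pairDim_cases (fun x hx => ?_) fun x hx => ?_
      · rw [entryFst_mem_range_pairPos_iff, not_or] at hx
        simp only [pairRep_entryFst, deformA, Matrix.add_apply]
        rw [starMatrix_of_not _ hx.1, add_zero]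
        refine pencilA_apply_congr fun a b ha hb => ?_
        have h1 := hx.2
        rw [ha, hb] at h1
        exact (hD' _).2 _ h1
      · rw [entrySnd_mem_range_pairPos_iff, not_or] at hx
        simp only [pairRep_entrySnd, deformB, Matrix.add_apply]
        rw [starMatrix_of_not _ hx.1, add_zero]
        refine pencilB_apply_congr fun a b ha hb => ?_
        have h1 := hx.2
        rw [ha, hb] at h1
        exact (hC' _).2 _ h1
  · exact ((isComplementary_pencil hp hp_mono hq hq_anti hD0 (isTransversal_loopRep_iff.1 hCt)
      (isTransversal_loopRep_iff.1 hDt)).congr (fun _ _ => entryFst_mem_range_pairPos_iff)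
      fun _ _ => entrySnd_mem_range_pairPos_iff).isTransversal_pairRep

theorem isSimplestMiniversal_loop [Fintype I] [DecidableEq I] {C : Matrix I I 𝕜}
    {S : I → I → Prop} (h : IsComplementary 1 C 1 C (fun _ _ => False) S) :
    IsSimplestMiniversal (loopRep C) fun t : Stars S → 𝕜 => loopRep (C + starMatrix S t) := by
  refine isSimplestMiniversal_iff.2 ⟨fun k => ⟨.star _, .star _, (), k.1.1, k.1.2⟩,
    fun k k' hk => ?_, fun t => ⟨fun k => ?_, fun e he => ?_⟩, ?_⟩
  · exact Subtype.ext (congrArg (fun e => ((e.row, e.col) : I × I)) hk)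
  · exact congrArg (C k.1.1 k.1.2 + ·) (starMatrix_of t k.2)
  · have h1 : ¬ S e.row e.col := fun h1 => he ⟨⟨(e.row, e.col), h1⟩, rfl⟩
    change C e.row e.col + starMatrix S t e.row e.col = C e.row e.col
    rw [starMatrix_of_not t h1, add_zero]
  · refine isTransversal_loopRep_iff.2 (h.congr (fun _ _ => Iff.rfl) fun a b => ?_)
    constructor
    · rintro ⟨k, hk⟩
      have : k.1 = (a, b) := congrArg (fun e => ((e.row, e.col) : I × I)) hk
      have h1 := k.2
      rwa [this] at h1
    · exact fun h1 => ⟨⟨(a, b), h1⟩, rfl⟩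

end PairDeformation

/-! ### Arrays of cells: the shift combined with a cell operator -/

section Arrays

variable {𝕜 G : Type} [RCLike 𝕜] [AddCommGroup G] [Module 𝕜 G]

/-- The operator `X ↦ X * N - N * X` on arrays, `N` being the shift matrix. -/
def shiftDiff (X : ℕ → ℕ → G) : ℕ → ℕ → G
  | a, 0 => -X (a + 1) 0
  | a, b + 1 => X a b - X (a + 1) (b + 1)

theorem map_shiftDiff (f : G →ₗ[𝕜] G) (X : ℕ → ℕ → G) (a b : ℕ) :
    f (shiftDiff X a b) = shiftDiff (fun a b => f (X a b)) a b := by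
  cases b <;> simp [shiftDiff]

theorem shiftDiff_add (X Y : ℕ → ℕ → G) (a b : ℕ) :
    shiftDiff (fun a b => X a b + Y a b) a b = shiftDiff X a b + shiftDiff Y a b := by
  cases b <;> simp only [shiftDiff] <;> abel

/-- The cells of an `s × s'` array that contain stars. -/
def starCell (s s' a b : ℕ) : Prop := if s ≤ s' then b = 0 else a + 1 = s

/-- The array with zero row `0` and with differences `c` along the diagonals. -/
def forwardRec (c : ℕ → ℕ → G) : ℕ → ℕ → G
  | 0, _ => 0
  | a + 1, 0 => c a 0
  | a + 1, b + 1 => forwardRec c a b + c a (b + 1)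

/-- This is the case of nilpotent Jordan blocks. With column `0` starred, the diagonals are filled
upwards from the zero row `s`; with the last row starred, downwards from a zero row `0`. -/
theorem exists_shiftDiff_eq (s s' : ℕ) (Y : ℕ → ℕ → G) : ∃ X : ℕ → ℕ → G, (∀ b, X s b = 0) ∧
    ∀ a b, a < s → b < s' → ¬ starCell s s' a b → shiftDiff X a b = Y a b := by
  by_cases h : s ≤ s'
  · refine ⟨fun a b => codiagRec (s + 1) (fun _ => 0) (fun a b => -Y a (b + 1)) (s - a) b,
      fun b => by simp [codiagRec], fun a b ha hb hab => ?_⟩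
    rw [starCell, if_pos h] at hab
    obtain ⟨b, rfl⟩ := Nat.exists_eq_succ_of_ne_zero hab
    simp only [shiftDiff, Nat.succ_eq_add_one]
    rw [show s - a = (s - (a + 1)) + 1 by omega]
    simp only [codiagRec]
    rw [show s + 1 - 2 - (s - (a + 1)) = a by omega]
    abel
  · refine ⟨fun a b => if a < s then forwardRec (fun a b => -Y a b) a b else 0,
      fun b => by simp, fun a b ha hb hab => ?_⟩
    rw [starCell, if_neg h] at hab
    have ha' : a + 1 < s := by omega
    cases b <;> simp [shiftDiff, ha, ha', forwardRec]

/-- The unstarred equations make `X` constant along diagonals. For `s ≤ s'` those through column `0`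
below row `0` run into the zero row `s`; for `s > s'` those below the main diagonal start at a zero
in column `0`. -/
theorem shiftDiff_eq_zero {s s' : ℕ} {X : ℕ → ℕ → G} (hX : ∀ b, X s b = 0)
    (h : ∀ a b, a < s → b < s' → ¬ starCell s s' a b → shiftDiff X a b = 0) {a b : ℕ}
    (ha : a < s) (hb : b < s') : shiftDiff X a b = 0 := by
  by_cases hab : starCell s s' a b
  swap
  · exact h a b ha hb hab
  by_cases hs : s ≤ s'
  · have h1 : ∀ k a b, a + k = s → b + k < s' → X a b = 0 := by
      intro k
      induction k with
      | zero =>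
        intro a b ha _
        rw [show a = s by omega, hX]
      | succ k ih =>
        intro a b ha hb
        have h2 := h a (b + 1) (by omega) (by omega) (by simp [starCell, hs])
        rw [shiftDiff, sub_eq_zero] at h2
        rw [h2]
        exact ih _ _ (by omega) (by omega)
    rw [starCell, if_pos hs] at hab
    subst hab
    rw [shiftDiff, h1 (s - (a + 1)) (a + 1) 0 (by omega) (by omega), neg_zero]
  · have h1 : ∀ b a, b < a → a < s → b < s' → X a b = 0 := by
      intro b
      induction b with
      | zero =>
        intro a ha has hb
        obtain ⟨a, rfl⟩ := Nat.exists_eq_succ_of_ne_zero (Nat.ne_zero_of_lt ha)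
        have h2 := h a 0 (by omega) hb (by rw [starCell, if_neg hs]; omega)
        rwa [shiftDiff, neg_eq_zero] at h2
      | succ b ih =>
        intro a ha has hb
        obtain ⟨a, rfl⟩ := Nat.exists_eq_succ_of_ne_zero (Nat.ne_zero_of_lt ha)
        have h2 := h a (b + 1) (by omega) hb (by rw [starCell, if_neg hs]; omega)
        rw [shiftDiff, sub_eq_zero] at h2
        rw [Nat.succ_eq_add_one, ← h2]
        exact ih _ (by omega) (by omega) (by omega)
    rw [starCell, if_neg hs] at hab
    cases b with
    | zero => rw [shiftDiff, hab, hX, neg_zero]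
    | succ b => rw [shiftDiff, hab, hX, h1 b a (by omega) ha (by omega), sub_zero]

/-- The subspace `W` is a complement of the range of `L`, and `L` has a group inverse. -/
def IsCellComplement (L : G →ₗ[𝕜] G) (W : Submodule 𝕜 G) : Prop :=
  ∃ M : G →ₗ[𝕜] G, (∀ g, M (L g) = L (M g)) ∧ (∀ g, L (M (L g)) = L g) ∧
    (∀ g, ∃ w ∈ W, w - L (M w) = g - L (M g)) ∧ ∀ w ∈ W, w - L (M w) = 0 → w = 0

/-- The solution of the equation `L X + shiftDiff X = Y` computed by means of an inverse `M` of `L`;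
its rows are numbered from below. -/
def cellRec (M : G →ₗ[𝕜] G) (s : ℕ) (Y : ℕ → ℕ → G) : ℕ → ℕ → G
  | 0, _ => 0
  | k + 1, 0 => M (Y (s - (k + 1)) 0 + cellRec M s Y k 0)
  | k + 1, b + 1 => M (Y (s - (k + 1)) (b + 1) + cellRec M s Y k (b + 1) - cellRec M s Y (k + 1) b)

/-- On the range of `L` the operator `M` inverts `L`, so each cell is found from those below it and
to its left, and no star is needed. -/
theorem exists_add_shiftDiff_eq {L M : G →ₗ[𝕜] G} (hML : ∀ g, M (L g) = L (M g))
    (s : ℕ) {Y : ℕ → ℕ → G} (hY : ∀ a b, L (M (Y a b)) = Y a b) :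
    ∃ X : ℕ → ℕ → G, (∀ b, X s b = 0) ∧
      ∀ a b, a < s → L (X a b) + shiftDiff X a b = Y a b := by
  have hM : ∀ g, L (M g) = g → L (M (M g)) = M g := fun g hg => by
    rw [← hML, hg]
  have h1 : ∀ k b, L (M (cellRec M s Y k b)) = cellRec M s Y k b := by
    intro k
    induction k with
    | zero => intro b; simp [cellRec]
    | succ k ih =>
      intro b
      induction b with
      | zero =>
        rw [cellRec]
        exact hM _ (by rw [map_add, map_add, hY, ih])
      | succ b ihb =>
        rw [cellRec]
        exact hM _ (by rw [map_sub, map_sub, map_add, map_add, hY, ih, ihb])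
  refine ⟨fun a b => cellRec M s Y (s - a) b, fun b => by simp [cellRec], fun a b ha => ?_⟩
  obtain ⟨k, hk⟩ : ∃ k, s - a = k + 1 := ⟨s - (a + 1), by omega⟩
  have hk' : s - (a + 1) = k := by omega
  have hk'' : s - (k + 1) = a := by omega
  cases b with
  | zero =>
    simp only [shiftDiff, hk, hk']
    rw [cellRec, map_add, map_add, hY, h1, hk'']
    abel
  | succ b =>
    simp only [shiftDiff, hk, hk']
    rw [cellRec, map_sub, map_sub, map_add, map_add, hY, h1, h1, hk'']
    abel

theorem IsCellComplement.exists_array {L : G →ₗ[𝕜] G} {W : Submodule 𝕜 G}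
    (h : IsCellComplement L W) (s s' : ℕ) (Y : ℕ → ℕ → G) :
    ∃ X : ℕ → ℕ → G, (∀ b, X s b = 0) ∧ ∀ a b, a < s → b < s' →
      (starCell s s' a b → L (X a b) + shiftDiff X a b - Y a b ∈ W) ∧
      (¬ starCell s s' a b → L (X a b) + shiftDiff X a b = Y a b) := by
  classical
  obtain ⟨M, hML, hLML, hW, -⟩ := h
  -- This is the projection onto the kernel of `L` along its range.
  set π : G →ₗ[𝕜] G := LinearMap.id - L ∘ₗ M with hπ
  have hπa : ∀ g, π g = g - L (M g) := fun g => rfl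
  have hLπ : ∀ g, L (π g) = 0 := fun g => by
    rw [hπa, map_sub, ← hML, hLML, sub_self]
  have hππ : ∀ g, π (π g) = π g := fun g => by
    rw [hπa (π g), ← hML, hLπ, map_zero, sub_zero]
  obtain ⟨X₀, hX₀, hX₀'⟩ := exists_shiftDiff_eq s s' Y
  choose w hwW hw using hW
  set V : ℕ → ℕ → G := fun a b => Y a b - shiftDiff (fun a b => π (X₀ a b)) a b with hV
  -- After the kernel part is solved off the stars, subtracting elements of `W` in the starred cells
  -- brings the remainder into the range of `L`.
  set U : ℕ → ℕ → G := fun a b => if starCell s s' a b then w (V a b) else 0 with hU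
  set T : ℕ → ℕ → G := fun a b => V a b - U a b - π (V a b - U a b) with hT
  have hπT : ∀ a b, L (M (T a b)) = T a b := fun a b => by
    have h1 : π (T a b) = 0 := by rw [hT]; simp only [map_sub, hππ, sub_self]
    rw [hπa, sub_eq_zero] at h1
    exact h1.symm
  have hT' : ∀ a b, a < s → b < s' → T a b = V a b - U a b := by
    intro a b ha hb
    have h1 : π (V a b - U a b) = 0 := by
      by_cases hab : starCell s s' a b
      · rw [map_sub, sub_eq_zero]
        simp only [hU, hab, if_true]
        exact (hw _).symm
      · simp only [hU, hab, if_false, sub_zero, hV]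
        rw [← map_shiftDiff, hX₀' a b ha hb hab, map_sub, hππ, sub_self]
    simp only [hT, h1, sub_zero]
  obtain ⟨X₂, hX₂, hX₂'⟩ := exists_add_shiftDiff_eq hML s hπT
  refine ⟨fun a b => π (X₀ a b) + X₂ a b, fun b => by simp [hX₀, hX₂], fun a b ha hb => ?_⟩
  have key : L (π (X₀ a b) + X₂ a b) + shiftDiff (fun a b => π (X₀ a b) + X₂ a b) a b
      = Y a b - U a b := by
    rw [shiftDiff_add, map_add, hLπ]
    have := hX₂' a b ha
    rw [hT' a b ha hb] at this
    simp only [hV] at this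
    rw [zero_add, add_left_comm, this]
    abel
  constructor
  · intro hab
    rw [key]
    simp only [hU, hab, if_true, sub_sub_cancel_left]
    exact W.neg_mem (hwW _)
  · intro hab
    rw [key]
    simp only [hU, hab, if_false, sub_zero]

/-- The projection onto the kernel of `L` kills the `L`-term and leaves the pure shift problem for
`π X`; an element of `W` with zero projection is zero. -/
theorem IsCellComplement.eq_zero_of_array {L : G →ₗ[𝕜] G} {W : Submodule 𝕜 G}
    (h : IsCellComplement L W) {s s' : ℕ} {X : ℕ → ℕ → G} (hX : ∀ b, X s b = 0)
    (h1 : ∀ a b, a < s → b < s' → starCell s s' a b → L (X a b) + shiftDiff X a b ∈ W)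
    (h2 : ∀ a b, a < s → b < s' → ¬ starCell s s' a b → L (X a b) + shiftDiff X a b = 0)
    {a b : ℕ} (ha : a < s) (hb : b < s') : L (X a b) + shiftDiff X a b = 0 := by
  obtain ⟨M, hML, hLML, -, hW⟩ := h
  set π : G →ₗ[𝕜] G := LinearMap.id - L ∘ₗ M with hπ
  have hπL : ∀ g, π (L g) = 0 := fun g => by
    change L g - L (M (L g)) = 0
    rw [hLML, sub_self]
  have hπT : ∀ a b, π (L (X a b) + shiftDiff X a b) = shiftDiff (fun a b => π (X a b)) a b :=
    fun a b => by rw [map_add, hπL, zero_add, map_shiftDiff]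
  by_cases hab : starCell s s' a b
  · refine hW _ (h1 a b ha hb hab) ((hπT a b).trans ?_)
    refine shiftDiff_eq_zero (fun b => by simp [hX]) (fun a b ha hb hab => ?_) ha hb
    rw [← hπT, h2 a b ha hb hab, map_zero]
  · exact h2 a b ha hb hab

end Arrays

/-! ### Sylvester operators on single cells -/

section Cells

variable {𝕜 : Type} [RCLike 𝕜]

/-- The operator `Y ↦ Y * c' - c * Y`. -/
def sylvester {m n : Type} [Fintype m] [Fintype n] (c : Matrix m m 𝕜) (c' : Matrix n n 𝕜) :
    Matrix m n 𝕜 →ₗ[𝕜] Matrix m n 𝕜 where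
  toFun Y := Y * c' - c * Y
  map_add' X Y := by rw [Matrix.add_mul, Matrix.mul_add]; abel
  map_smul' a X := by simp [smul_sub]

theorem sylvester_apply {m n : Type} [Fintype m] [Fintype n] (c : Matrix m m 𝕜)
    (c' : Matrix n n 𝕜) (Y : Matrix m n 𝕜) : sylvester c c' Y = Y * c' - c * Y := rfl

/-- The matrices with entries supported on `P`. -/
def supportedOn (𝕜 : Type) [RCLike 𝕜] {m n : Type} (P : m → n → Prop) :
    Submodule 𝕜 (Matrix m n 𝕜) where
  carrier := {g | ∀ i j, ¬ P i j → g i j = 0}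
  add_mem' ha hb i j h := by simp [ha i j h, hb i j h]
  zero_mem' := by simp
  smul_mem' c x hx i j h := by simp [hx i j h]

theorem mem_supportedOn {m n : Type} {P : m → n → Prop} {g : Matrix m n 𝕜} :
    g ∈ supportedOn 𝕜 P ↔ ∀ i j, ¬ P i j → g i j = 0 := Iff.rfl

theorem isCellComplement_of_injective {G : Type} [AddCommGroup G] [Module 𝕜 G]
    [FiniteDimensional 𝕜 G] {L : G →ₗ[𝕜] G} (hL : Function.Injective L) {W : Submodule 𝕜 G}
    (hW : ∀ w ∈ W, w = 0) : IsCellComplement L W := by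
  set e := LinearEquiv.ofInjectiveEndo L hL with he
  have h1 : ∀ g, L (e.symm g) = g := fun g => e.apply_symm_apply g
  have h2 : ∀ g, e.symm (L g) = g := fun g => e.symm_apply_apply g
  refine ⟨e.symm.toLinearMap, fun g => ?_, fun g => ?_, fun g => ⟨0, W.zero_mem, ?_⟩,
    fun w hw _ => hW w hw⟩
  · exact (h2 g).trans (h1 g).symm
  · exact h1 (L g)
  · simp [h1]

theorem isCellComplement_zero {G : Type} [AddCommGroup G] [Module 𝕜 G] {L : G →ₗ[𝕜] G}
    (hL : L = 0) {W : Submodule 𝕜 G} (hW : ∀ w, w ∈ W) : IsCellComplement L W := by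
  subst hL
  exact ⟨0, by simp, by simp, fun g => ⟨g, hW g, rfl⟩, by simp⟩

theorem sylvester_scalar_injective {a a' : 𝕜} (h : a ≠ a') :
    Function.Injective (sylvester (!![a] : Matrix (Fin 1) (Fin 1) 𝕜) !![a']) := by
  rw [injective_iff_map_eq_zero]
  intro Y hY
  rw [sylvester_apply] at hY
  have h0 := congrFun (congrFun hY 0) 0
  simp [Matrix.mul_apply, Matrix.vecMul, dotProduct] at h0
  have : (a' - a) * Y 0 0 = 0 := by linear_combination h0
  ext i j
  fin_cases i; fin_cases j
  exact (mul_eq_zero.1 this).resolve_left (sub_ne_zero.2 h.symm)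

theorem sylvester_scalar_self (a : 𝕜) :
    sylvester (!![a] : Matrix (Fin 1) (Fin 1) 𝕜) !![a] = 0 := by
  ext Y i j
  rw [sylvester_apply]
  fin_cases i; fin_cases j
  simp [Matrix.mul_apply, Matrix.vecMul, dotProduct, mul_comm]

/-- A nonreal label occurs only over the reals, so a scalar label beside it is real and cannot be an
eigenvalue of the rotation cell. -/
theorem exists_ofReal_eq (h𝕜 : (RCLike.I : 𝕜) = 0) (x : 𝕜) : ∃ t : ℝ, (t : 𝕜) = x :=
  ⟨RCLike.re x, by simpa [h𝕜] using RCLike.re_add_im x⟩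

theorem eq_zero_of_rotation {δ b : ℝ} (hb : δ ^ 2 + b ^ 2 ≠ 0) {u v : 𝕜}
    (h1 : (δ : 𝕜) * u - b * v = 0) (h2 : (b : 𝕜) * u + δ * v = 0) : u = 0 ∧ v = 0 := by
  have hD : ((δ : 𝕜) ^ 2 + (b : 𝕜) ^ 2) ≠ 0 := by exact_mod_cast hb
  constructor
  · refine (mul_eq_zero.1 (?_ : ((δ : 𝕜) ^ 2 + (b : 𝕜) ^ 2) * u = 0)).resolve_left hD
    linear_combination (δ : 𝕜) * h1 + (b : 𝕜) * h2
  · refine (mul_eq_zero.1 (?_ : ((δ : 𝕜) ^ 2 + (b : 𝕜) ^ 2) * v = 0)).resolve_left hD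
    linear_combination (δ : 𝕜) * h2 - (b : 𝕜) * h1

theorem sylvester_scalar_rotation_injective {x a b : ℝ} (hb : 0 < b) :
    Function.Injective (sylvester (!![(x : 𝕜)] : Matrix (Fin 1) (Fin 1) 𝕜)
      !![(a : 𝕜), (b : 𝕜); -(b : 𝕜), (a : 𝕜)]) := by
  rw [injective_iff_map_eq_zero]
  intro Y hY
  rw [sylvester_apply] at hY
  have h0 := congrFun (congrFun hY 0) 0
  have h1 := congrFun (congrFun hY 0) 1
  simp [Matrix.mul_apply, Matrix.vecMul, dotProduct, Fin.sum_univ_two] at h0 h1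
  obtain ⟨h2, h3⟩ := eq_zero_of_rotation (𝕜 := 𝕜) (δ := a - x) (b := b) (u := Y 0 0) (v := Y 0 1)
    (by positivity) (by push_cast; linear_combination h0) (by push_cast; linear_combination h1)
  ext i j
  fin_cases i; fin_cases j
  · exact h2
  · exact h3

theorem sylvester_rotation_scalar_injective {x a b : ℝ} (hb : 0 < b) :
    Function.Injective (sylvester
      (!![(a : 𝕜), (b : 𝕜); -(b : 𝕜), (a : 𝕜)] : Matrix (Fin 2) (Fin 2) 𝕜)
      (!![(x : 𝕜)] : Matrix (Fin 1) (Fin 1) 𝕜)) := by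
  rw [injective_iff_map_eq_zero]
  intro Y hY
  rw [sylvester_apply] at hY
  have h0 := congrFun (congrFun hY 0) 0
  have h1 := congrFun (congrFun hY 1) 0
  simp [Matrix.mul_apply, Matrix.vecMul, dotProduct, Fin.sum_univ_two] at h0 h1
  obtain ⟨h2, h3⟩ := eq_zero_of_rotation (𝕜 := 𝕜) (δ := x - a) (b := b) (u := Y 0 0) (v := Y 1 0)
    (by positivity) (by push_cast; linear_combination h0) (by push_cast; linear_combination h1)
  ext i j
  fin_cases j; fin_cases i
  · exact h2
  · exact h3

theorem sylvester_rotation_injective {a b a' b' : ℝ} (hb : 0 < b) (hb' : 0 < b')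
    (h : a = a' → b ≠ b') :
    Function.Injective (sylvester
      (!![(a : 𝕜), (b : 𝕜); -(b : 𝕜), (a : 𝕜)] : Matrix (Fin 2) (Fin 2) 𝕜)
      (!![(a' : 𝕜), (b' : 𝕜); -(b' : 𝕜), (a' : 𝕜)] : Matrix (Fin 2) (Fin 2) 𝕜)) := by
  rw [injective_iff_map_eq_zero]
  intro Y hY
  rw [sylvester_apply] at hY
  have h0 := congrFun (congrFun hY 0) 0
  have h1 := congrFun (congrFun hY 0) 1
  have h2 := congrFun (congrFun hY 1) 0
  have h3 := congrFun (congrFun hY 1) 1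
  simp [Matrix.mul_apply, Matrix.vecMul, dotProduct, Fin.sum_univ_two] at h0 h1 h2 h3
  have hD : (a' - a) ^ 2 + (b' - b) ^ 2 ≠ 0 := by
    intro hD
    have e1 : a' - a = 0 := by nlinarith [sq_nonneg (a' - a), sq_nonneg (b' - b)]
    have e2 : b' - b = 0 := by nlinarith [sq_nonneg (a' - a), sq_nonneg (b' - b)]
    exact h (by linarith) (by linarith)
  -- The combinations `Y₀₀ ± Y₁₁` and `Y₀₁ ∓ Y₁₀` split the system into two rotations, with
  -- parameters `b' - b` and `b' + b`; the second is always nonsingular.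
  obtain ⟨h4, h5⟩ := eq_zero_of_rotation (𝕜 := 𝕜) (δ := a' - a) (b := b' - b)
    (u := Y 0 0 + Y 1 1) (v := Y 0 1 - Y 1 0) hD (by push_cast; linear_combination h0 + h3)
    (by push_cast; linear_combination h1 - h2)
  obtain ⟨h6, h7⟩ := eq_zero_of_rotation (𝕜 := 𝕜) (δ := a' - a) (b := b' + b)
    (u := Y 0 0 - Y 1 1) (v := Y 0 1 + Y 1 0) (by positivity)
    (by push_cast; linear_combination h0 - h3) (by push_cast; linear_combination h1 + h2)
  ext i j
  fin_cases i <;> fin_cases j <;> simp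
  · linear_combination (h4 + h6) / 2
  · linear_combination (h5 + h7) / 2
  · linear_combination (h7 - h5) / 2
  · linear_combination (h4 - h6) / 2

/-- This is Sylvester's theorem: cells with different labels have no common complex eigenvalue,
thanks to the normalization `b > 0`. -/
theorem JordanLabel.sylvester_injective {e e' : JordanLabel 𝕜} (h : e ≠ e') :
    Function.Injective (sylvester e.cell e'.cell) := by
  rcases e with a | ⟨a, b, hb, h𝕜⟩ <;> rcases e' with a' | ⟨a', b', hb', h𝕜'⟩
  · exact sylvester_scalar_injective fun haa => h (by rw [haa])
  · obtain ⟨x, rfl⟩ := exists_ofReal_eq h𝕜' a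
    exact sylvester_scalar_rotation_injective hb'
  · obtain ⟨x, rfl⟩ := exists_ofReal_eq h𝕜 a'
    exact sylvester_rotation_scalar_injective hb
  · refine sylvester_rotation_injective hb hb' fun haa hbb => h ?_
    subst haa hbb
    rfl

/-- The places of the stars in a cell that contains stars: the first column or the last row. -/
def starInCell (w : ℕ) (P : Prop) (i j : Fin w) : Prop := (P ∧ j.val = 0) ∨ (¬ P ∧ i.val + 1 = w)

theorem isCellComplement_rotation {a b : ℝ} (hb : 0 < b) (P : Prop) :
    IsCellComplement (sylvester
      (!![(a : 𝕜), (b : 𝕜); -(b : 𝕜), (a : 𝕜)] : Matrix (Fin 2) (Fin 2) 𝕜)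
      (!![(a : 𝕜), (b : 𝕜); -(b : 𝕜), (a : 𝕜)] : Matrix (Fin 2) (Fin 2) 𝕜))
      (supportedOn 𝕜 (starInCell 2 P)) := by
  set L := sylvester
      (!![(a : 𝕜), (b : 𝕜); -(b : 𝕜), (a : 𝕜)] : Matrix (Fin 2) (Fin 2) 𝕜)
      (!![(a : 𝕜), (b : 𝕜); -(b : 𝕜), (a : 𝕜)] : Matrix (Fin 2) (Fin 2) 𝕜) with hL
  have hb0 : (b : 𝕜) ≠ 0 := by exact_mod_cast hb.ne'
  have hLY : ∀ Y, L Y = !![-(b : 𝕜) * (Y 0 1 + Y 1 0), (b : 𝕜) * (Y 0 0 - Y 1 1);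
      (b : 𝕜) * (Y 0 0 - Y 1 1), (b : 𝕜) * (Y 0 1 + Y 1 0)] := fun Y => by
    rw [hL, sylvester_apply]
    ext i j
    fin_cases i <;> fin_cases j <;> simp [Matrix.mul_apply, Matrix.vecMul, dotProduct, Fin.sum_univ_two] <;> ring
  have hproj : ∀ Y, Y - L ((-(4 * (b : 𝕜) ^ 2)⁻¹ • L) Y) =
      !![(Y 0 0 + Y 1 1) / 2, (Y 0 1 - Y 1 0) / 2; (Y 1 0 - Y 0 1) / 2, (Y 0 0 + Y 1 1) / 2] :=
    fun Y => by
    rw [LinearMap.smul_apply, map_smul, hLY, hLY]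
    ext i j
    fin_cases i <;> fin_cases j <;> simp <;> field_simp <;> ring
  -- Here `L ^ 3 = -4 b ^ 2 L`, so this multiple of `L` is its group inverse.
  refine ⟨-(4 * (b : 𝕜) ^ 2)⁻¹ • L, fun g => ?_, fun g => ?_, fun g => ?_, fun w hw h => ?_⟩
  · rw [LinearMap.smul_apply, LinearMap.smul_apply, map_smul]
  · have h : L g - L ((-(4 * (b : 𝕜) ^ 2)⁻¹ • L) (L g)) = 0 := by
      rw [hproj, hLY g]
      ext i j
      fin_cases i <;> fin_cases j <;> simp
    exact (sub_eq_zero.1 h).symm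
  · by_cases hP : P
    -- The projection depends only on the sum of the diagonal entries and the difference of the
    -- others, and one column can carry both.
    · refine ⟨!![g 0 0 + g 1 1, 0; g 1 0 - g 0 1, 0], fun i j hij => ?_, ?_⟩
      · fin_cases i <;> fin_cases j <;> simp [starInCell, hP] at hij ⊢
      · rw [hproj, hproj]
        ext i j
        fin_cases i <;> fin_cases j <;> simp
    · refine ⟨!![0, 0; g 1 0 - g 0 1, g 0 0 + g 1 1], fun i j hij => ?_, ?_⟩
      · fin_cases i <;> fin_cases j <;> simp [starInCell, hP] at hij ⊢
      · rw [hproj, hproj]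
        ext i j
        fin_cases i <;> fin_cases j <;> simp
  · rw [hproj] at h
    have h0 := congrFun (congrFun h 0) 0
    have h1 := congrFun (congrFun h 0) 1
    simp at h0 h1
    rw [mem_supportedOn] at hw
    by_cases hP : P
    · have e1 := hw 0 1 (by simp [starInCell, hP])
      have e2 := hw 1 1 (by simp [starInCell, hP])
      rw [e2, add_zero] at h0
      rw [e1, zero_sub, neg_eq_zero] at h1
      ext i j
      fin_cases i <;> fin_cases j <;> simp [e1, e2, h0, h1]
    · have e1 := hw 0 0 (by simp [starInCell, hP])
      have e2 := hw 0 1 (by simp [starInCell, hP])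
      rw [e1, zero_add] at h0
      rw [e2, zero_sub, neg_eq_zero] at h1
      ext i j
      fin_cases i <;> fin_cases j <;> simp [e1, e2, h0, h1]

theorem JordanLabel.isCellComplement (e : JordanLabel 𝕜) (P : Prop) :
    IsCellComplement (sylvester e.cell e.cell) (supportedOn 𝕜 (starInCell e.width P)) := by
  rcases e with a | ⟨a, b, hb, h𝕜⟩
  · refine isCellComplement_zero ?_ fun w i j h => ?_
    · exact sylvester_scalar_self a
    · have hi : i.val < 1 := i.2
      have hj : j.val < 1 := j.2
      refine absurd ?_ h
      by_cases hP : P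
      · exact .inl ⟨hP, by omega⟩
      · exact .inr ⟨hP, by change i.val + 1 = 1; omega⟩
  · exact isCellComplement_rotation hb P

end Cells

/-! ### Jordan matrices -/

section Jordan

variable {𝕜 : Type} [RCLike 𝕜]

theorem jordanBlock_apply (e : JordanLabel 𝕜) (s : ℕ) (x y : Fin s × Fin e.width) :
    jordanBlock e s x y = (if x.1 = y.1 then e.cell x.2 y.2 else 0) +
      if x.1.val + 1 = y.1.val then (if x.2 = y.2 then 1 else 0) else 0 := by
  rw [jordanBlock]
  by_cases h : x.1 = y.1
  · have : ¬ x.1.val + 1 = y.1.val := by rw [h]; omega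
    rw [if_pos h, if_pos h, if_neg this, add_zero]
  · rw [if_neg h, if_neg h, zero_add]
    rfl

theorem mul_jordanBlock_apply {α : Type} (e : JordanLabel 𝕜) (s : ℕ)
    (X : Matrix α (Fin s × Fin e.width) 𝕜) (x : α) (b : Fin s) (j : Fin e.width) :
    (X * jordanBlock e s) x (b, j) = ∑ k, X x (b, k) * e.cell k j +
      if h : 0 < b.val then X x (⟨b - 1, by omega⟩, j) else 0 := by
  simp only [Matrix.mul_apply, jordanBlock_apply, mul_add, Finset.sum_add_distrib]
  congr 1
  · rw [Fintype.sum_prod_type, Finset.sum_eq_single b] <;> simp +contextual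
  · split_ifs with h
    · rw [Finset.sum_eq_single (⟨b - 1, by omega⟩, j)]
      · simp [Nat.sub_add_cancel h]
      · rintro ⟨b', k⟩ _ hk
        split_ifs with h1 h2
        · refine absurd (Prod.ext (Fin.ext ?_) h2) hk
          change b'.val + 1 = b.val at h1
          change b'.val = b.val - 1
          omega
        · rw [mul_zero]
        · rw [mul_zero]
      · simp
    · refine Finset.sum_eq_zero fun z _ => ?_
      rw [if_neg (by omega), mul_zero]

theorem jordanBlock_mul_apply {β : Type} (e : JordanLabel 𝕜) (s : ℕ)
    (X : Matrix (Fin s × Fin e.width) β 𝕜) (a : Fin s) (i : Fin e.width) (y : β) :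
    (jordanBlock e s * X) (a, i) y = ∑ k, e.cell i k * X (a, k) y +
      if h : a.val + 1 < s then X (⟨a + 1, h⟩, i) y else 0 := by
  simp only [Matrix.mul_apply, jordanBlock_apply, add_mul, Finset.sum_add_distrib]
  congr 1
  · rw [Fintype.sum_prod_type, Finset.sum_eq_single a] <;> simp +contextual [eq_comm]
  · split_ifs with h
    · rw [Finset.sum_eq_single (⟨a + 1, h⟩, i)]
      · simp
      · rintro ⟨a', k⟩ _ hk
        split_ifs with h1 h2
        · exact absurd (Prod.ext (Fin.ext h1.symm) h2.symm) hk
        · rw [zero_mul]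
        · rw [zero_mul]
      · simp
    · refine Finset.sum_eq_zero fun z _ => ?_
      have := z.1.2
      rw [if_neg (by omega), zero_mul]

/-- The matrix with the cells `X a b`. -/
def cellMatrix {w w' : ℕ} (s s' : ℕ) (X : ℕ → ℕ → Matrix (Fin w) (Fin w') 𝕜) :
    Matrix (Fin s × Fin w) (Fin s' × Fin w') 𝕜 :=
  fun x y => X x.1 y.1 x.2 y.2

theorem exists_cellMatrix_eq {w w' s s' : ℕ} (Y : Matrix (Fin s × Fin w) (Fin s' × Fin w') 𝕜) :
    ∃ X, (∀ b, X s b = 0) ∧ cellMatrix s s' X = Y := by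
  refine ⟨fun a b => Matrix.of fun i j => if h : a < s ∧ b < s' then
    Y (⟨a, h.1⟩, i) (⟨b, h.2⟩, j) else 0, fun b => ?_, ?_⟩
  · ext i j
    simp
  · ext ⟨a, i⟩ ⟨b, j⟩
    simp [cellMatrix]

theorem cellMatrix_mul_jordanBlock_sub (e e' : JordanLabel 𝕜) (s s' : ℕ)
    {X : ℕ → ℕ → Matrix (Fin e.width) (Fin e'.width) 𝕜} (hX : ∀ b, X s b = 0)
    (x : Fin s × Fin e.width) (y : Fin s' × Fin e'.width) :
    (cellMatrix s s' X * jordanBlock e' s' - jordanBlock e s * cellMatrix s s' X) x y =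
      (sylvester e.cell e'.cell (X x.1 y.1) + shiftDiff X x.1 y.1) x.2 y.2 := by
  obtain ⟨a, i⟩ := x
  obtain ⟨⟨b, hb⟩, j⟩ := y
  have h1 : (if h : a.val + 1 < s then cellMatrix s s' X (⟨a + 1, h⟩, i) (⟨b, hb⟩, j) else 0) =
      X (a + 1) b i j := by
    split_ifs with h
    · rfl
    · rw [show a.val + 1 = s by omega, hX]
      rfl
  rw [Matrix.sub_apply, mul_jordanBlock_apply, jordanBlock_mul_apply, h1, sylvester_apply]
  cases b with
  | zero =>
    simp only [shiftDiff, cellMatrix, Matrix.add_apply, Matrix.sub_apply, Matrix.neg_apply,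
      Matrix.mul_apply, lt_irrefl, dite_false]
    ring
  | succ b =>
    simp only [shiftDiff, cellMatrix, Matrix.add_apply, Matrix.sub_apply,
      Matrix.mul_apply, Nat.succ_pos, dite_true, Nat.add_sub_cancel]
    ring

theorem isComplementary_jordanBlock {e e' : JordanLabel 𝕜}
    {P : Fin e.width → Fin e'.width → Prop}
    (h : IsCellComplement (sylvester e.cell e'.cell) (supportedOn 𝕜 P)) (s s' : ℕ) :
    IsComplementary 1 (jordanBlock e s) 1 (jordanBlock e' s') (fun _ _ => False)
      (fun x y => starCell s s' x.1 y.1 ∧ P x.2 y.2) := by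
  refine isComplementary_one_iff.2 ⟨fun N => ?_, fun S hS => ?_⟩
  · obtain ⟨Y, -, rfl⟩ := exists_cellMatrix_eq N
    obtain ⟨X, hX0, hX⟩ := h.exists_array s s' Y
    refine ⟨cellMatrix s s' X, fun x y hxy => ?_⟩
    rw [cellMatrix_mul_jordanBlock_sub e e' s s' hX0]
    by_cases hc : starCell s s' x.1 y.1
    · have := (hX x.1 y.1 x.1.2 y.1.2).1 hc x.2 y.2 fun hP => hxy ⟨hc, hP⟩
      exact sub_eq_zero.1 this
    · rw [(hX x.1 y.1 x.1.2 y.1.2).2 hc]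
      rfl
  · obtain ⟨X, hX0, rfl⟩ := exists_cellMatrix_eq S
    simp only [cellMatrix_mul_jordanBlock_sub e e' s s' hX0] at hS
    ext x y
    rw [cellMatrix_mul_jordanBlock_sub e e' s s' hX0, h.eq_zero_of_array hX0
      (fun a b ha hb _ i j hP => hS (⟨a, ha⟩, i) (⟨b, hb⟩, j) fun h1 => hP h1.2)
      (fun a b ha hb hab => ?_) x.1.2 y.1.2]
    · rfl
    · ext i j
      exact hS (⟨a, ha⟩, i) (⟨b, hb⟩, j) fun h1 => hab h1.1

theorem isComplementary_jordanBlock_of_ne {e e' : JordanLabel 𝕜} (h : e ≠ e') (s s' : ℕ) :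
    IsComplementary 1 (jordanBlock e s) 1 (jordanBlock e' s') (fun _ _ => False)
      (fun _ _ => False) := by
  refine (isComplementary_jordanBlock (P := fun _ _ => False) (isCellComplement_of_injective
    (JordanLabel.sylvester_injective h) fun w hw => ?_) s s').congr (fun _ _ => Iff.rfl) (by simp)
  ext i j
  exact hw i j id

theorem JordanLabel.width_pos (e : JordanLabel 𝕜) : 0 < e.width := by
  cases e <;> simp [JordanLabel.width]

theorem isComplementary_jordanBlock_self (e : JordanLabel 𝕜) (s s' : ℕ) :
    IsComplementary 1 (jordanBlock e s) 1 (jordanBlock e s') (fun _ _ => False) starH := by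
  refine (isComplementary_jordanBlock (e.isCellComplement (s ≤ s')) s s').congr
    (fun _ _ => Iff.rfl) fun x y => ?_
  -- With equal cell widths, `starH` compares numbers of cells; its stars are the starred line of a
  -- cell within the starred line of cells.
  simp only [starH, starCell, starInCell, Nat.mul_le_mul_right_iff e.width_pos]
  by_cases h : s ≤ s' <;> simp [h]

theorem isComplementary_one_blockDiagonal' {o : Type} [Fintype o] [DecidableEq o] {m : o → Type}
    [∀ i, Fintype (m i)] [∀ i, DecidableEq (m i)] {C : ∀ i, Matrix (m i) (m i) 𝕜}
    {Q : (Σ i, m i) → (Σ i, m i) → Prop}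
    (h : ∀ i j, IsComplementary 1 (C i) 1 (C j) (fun _ _ => False)
      (fun a b => Q ⟨i, a⟩ ⟨j, b⟩)) :
    IsComplementary 1 (blockDiagonal' C) 1 (blockDiagonal' C) (fun _ _ => False) Q := by
  rw [← blockDiagonal'_one]
  exact .blockDiagonal'_left fun i => .blockDiagonal'_right fun j => h i j

theorem isComplementary_phi (e : JordanLabel 𝕜) {d : ℕ} (s : Fin d → ℕ) :
    IsComplementary 1 (phi e s) 1 (phi e s) (fun _ _ => False) (starPhi e s) :=
  isComplementary_one_blockDiagonal' fun i j => isComplementary_jordanBlock_self e (s i) (s j)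

theorem isComplementary_phi_of_ne {e e' : JordanLabel 𝕜} (h : e ≠ e') {d d' : ℕ} (s : Fin d → ℕ)
    (s' : Fin d' → ℕ) :
    IsComplementary 1 (phi e s) 1 (phi e' s') (fun _ _ => False) (fun _ _ => False) := by
  rw [← blockDiagonal'_one, ← blockDiagonal'_one]
  exact .blockDiagonal'_left fun i => .blockDiagonal'_right fun j =>
    isComplementary_jordanBlock_of_ne h (s i) (s' j)

theorem JordanData.isComplementary (c : JordanData 𝕜) :
    IsComplementary 1 c.matrix 1 c.matrix (fun _ _ => False) c.star := by
  refine isComplementary_one_blockDiagonal' fun i j => ?_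
  by_cases h : i = j
  · subst h
    exact (isComplementary_phi (c.label i) (c.size i)).congr (fun _ _ => Iff.rfl)
      fun a b => by simp [JordanData.star, starPhi]
  · exact (isComplementary_phi_of_ne (c.label_injective.ne h) (c.size i) (c.size j)).congr
      (fun _ _ => Iff.rfl) fun a b => by simp [JordanData.star, h]

/-- A nonzero entry of `D` strictly raises the height from row to column, so one of `D ^ k` raises
it by at least `k`. -/
theorem pow_apply_eq_zero_of_height {J : Type} [Fintype J] [DecidableEq J] {D : Matrix J J 𝕜}
    (ht : J → ℕ) (h : ∀ i j, ht j ≤ ht i → D i j = 0) (k : ℕ) (i j : J) (hij : ht j < ht i + k) :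
    (D ^ k) i j = 0 := by
  induction k generalizing j with
  | zero =>
    rw [pow_zero, Matrix.one_apply_ne]
    rintro rfl
    omega
  | succ k ih =>
    rw [pow_succ, Matrix.mul_apply]
    refine Finset.sum_eq_zero fun m _ => ?_
    by_cases hm : ht m < ht i + k
    · rw [ih m hm, zero_mul]
    · rw [h m j (by omega), mul_zero]

theorem exists_phi_zero_pow_eq_zero {d : ℕ} (s : Fin d → ℕ) :
    ∃ k, phi (.scalar (0 : 𝕜)) s ^ k = 0 := by
  -- This exponent exceeds every height, the height being the position inside a Jordan block.
  refine ⟨∑ j, s j, ?_⟩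
  ext i j
  refine pow_apply_eq_zero_of_height (fun x => x.2.1.val) ?_ _ i j ?_
  · rintro ⟨i, x⟩ ⟨j, y⟩ hxy
    by_cases h : i = j
    · subst h
      rw [phi, blockDiagonal'_apply_eq, jordanBlock_apply]
      have h1 : ¬ x.1.val + 1 = y.1.val := by simp only at hxy; omega
      rw [if_neg h1, add_zero]
      split_ifs
      · change (!![(0 : 𝕜)] : Matrix (Fin 1) (Fin 1) 𝕜) x.2 y.2 = 0
        have : ∀ a b : Fin 1, (!![(0 : 𝕜)] : Matrix (Fin 1) (Fin 1) 𝕜) a b = 0 := fun a b => by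
          fin_cases a; fin_cases b; rfl
        exact this _ _
      · rfl
    · rw [phi, blockDiagonal'_apply_ne _ _ _ h]
  · have h1 := j.2.1.2
    have h2 : s j.1 ≤ ∑ j, s j := Finset.single_le_sum (fun _ _ => Nat.zero_le _) (Finset.mem_univ _)
    omega

end Jordan

end PencilDeformation

end

open PencilDeformation in
theorem theorem4p1 {𝕜 : Type} [RCLike 𝕜] {l r d : ℕ}
    (p : Fin l → ℕ) (hp : ∀ i, 1 ≤ p i) (hp_mono : Monotone p)
    (q : Fin r → ℕ) (hq : ∀ j, 1 ≤ q j) (hq_anti : Antitone q)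
    (c : JordanData 𝕜)
    (s : Fin d → ℕ) (hs : ∀ j, 1 ≤ s j) (hs_anti : Antitone s) :
    -- arbitrary simplest miniversal deformations `C'` of `C` and `D'` of `D = Φ(0)`
    (∀ (ιC ιD : Type) [Fintype ιC] [Fintype ιD]
        (C' : (ιC → 𝕜) → Matrix c.Index c.Index 𝕜)
        (D' : (ιD → 𝕜) → Matrix (PhiIndex (.scalar (0 : 𝕜)) s) (PhiIndex (.scalar (0 : 𝕜)) s) 𝕜),
      IsSimplestMiniversal (loopRep c.matrix) (fun t => loopRep (C' t)) →
      IsSimplestMiniversal (loopRep (phi (.scalar (0 : 𝕜)) s)) (fun t => loopRep (D' t)) →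
      IsSimplestMiniversal
        (pairRep (pencilA p q (I := c.Index) (phi (.scalar (0 : 𝕜)) s)) (pencilB p q c.matrix))
        (fun t : Params p q c.Index (PhiIndex (.scalar (0 : 𝕜)) s) ιC ιD → 𝕜 =>
          pairRep (deformA p q D' t) (deformB p q C' t))) ∧
    -- in particular one may take the explicit ones, `C + ⊕ ℋᵢ` and `D + ℋ`
    IsSimplestMiniversal (loopRep c.matrix)
      (fun t : Stars c.star → 𝕜 => loopRep (c.matrix + starMatrix c.star t)) ∧
    IsSimplestMiniversal (loopRep (phi (.scalar (0 : 𝕜)) s))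
      (fun t : Stars (starPhi (.scalar (0 : 𝕜)) s) → 𝕜 =>
        loopRep (phi (.scalar (0 : 𝕜)) s + starMatrix (starPhi (.scalar (0 : 𝕜)) s) t)) := by
  obtain ⟨k, hk⟩ := exists_phi_zero_pow_eq_zero (𝕜 := 𝕜) s
  exact ⟨fun ιC ιD _ _ C' D' hC hD =>
    isSimplestMiniversal_pair hp hp_mono hq hq_anti hk hC hD,
    isSimplestMiniversal_loop c.isComplementary,
    isSimplestMiniversal_loop (isComplementary_phi (.scalar 0) s)⟩
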